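/- For a set $X$ consider the following operations on partial functions $f,g\colon X\to X$ (identified with their graphs): composition $f;g=\{(x,y)\mid \exists z\ (x,z)\in f,\ (z,y)\in g\}$; intersection $f\cdot g$; domain $\mathsf d(f)=\{(x,x)\mid x\in\operatorname{dom} f\}$; range $\mathsf r(f)=\{(y,y)\mid y\in\operatorname{ran} f\}$; antidomain $\mathsf a(f)=\{(x,x)\mid x\in X\setminus\operatorname{dom} f\}$; preferential union $f\sqcup g$, whose value at $x$ is $f(x)$ if this is defined and $g(x)$ otherwise; and maximum iterate $f^{\uparrow}=\bigsqcup_{n<\omega}f^n;\mathsf a(f)$, where $f^0$ is the identity. For a set $\tau$ of these operations, a $\tau$-algebra is *representable* if it is isomorphic to a family of partial functions on some set $X$ that is closed under the operations in $\tau$, with those operations. In an algebra with operations $;$ and $\mathsf a$ put $\mathsf d(x)=\mathsf a(\mathsf a(x))$, call $\alpha$ a *domain element* if $\mathsf d(\alpha)=\alpha$, and write $\alpha\vee\beta=\mathsf a(\mathsf a(\alpha);\mathsf a(\beta))$. Greek letters denote domain elements. Consider the laws: * (Ass) $(x;y);z=x;(y;z)$. * (Dom) $\mathsf d(x);x=x$;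 $\mathsf d(x);\mathsf d(y)=\mathsf d(y);\mathsf d(x)$; $\mathsf d(\mathsf d(x))=\mathsf d(x)$; $\mathsf d(x);\mathsf d(x;y)=\mathsf d(x;y)$; $x;\mathsf d(y)=\mathsf d(x;y);x$. * (Meet) $\cdot$ is associative, commutative and idempotent; $x;(y\cdot z)=(x;y)\cdot(x;z)$; $x\cdot y=\mathsf d(x\cdot y);x$. * (Antidom) $\mathsf a(x);x=\mathsf a(y);y$ (this element is called $0$, and $1'$ denotes $\mathsf a(0)$); $0;y=0$; $1';y=y$; $\mathsf a(x);\mathsf a(y)=\mathsf a(y);\mathsf a(x)$; $x;\mathsf a(y)=\mathsf a(x;y);x$; and if $\alpha;x=\alpha;y$ and $\mathsf a(\alpha);x=\mathsf a(\alpha);y$ then $x=y$. * (Ran) $x;\mathsf r(x)=x$; $\mathsf r(x);\mathsf r(y)=\mathsf r(y);\mathsf r(x)$; $\mathsf r(\mathsf r(x))=\mathsf r(x)$; $\mathsf r(x;y);\mathsf r(y)=\mathsf r(x;y)$; $\mathsf r(\mathsf r(x);y)=\mathsf r(x;y)$; and if $x;y=x;z$ then $\mathsf r(x);y=\mathsf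 r(x);z$. * (DR) $\mathsf d(\mathsf r(x))=\mathsf r(x)$ and $\mathsf r(\mathsf d(x))=\mathsf d(x)$. * (Antirange) $\mathsf r(\alpha;x)\vee\mathsf r(\beta;x)=\mathsf r((\alpha\vee\beta);x)$. * (Pref) $\mathsf d(x);(x\sqcup y)=x$ and $\mathsf a(x);(x\sqcup y)=\mathsf a(x);y$. * (Iter) $\mathsf d(x);x^{\uparrow}=x;x^{\uparrow}$; $\mathsf a(x);x^{\uparrow}=\mathsf a(x)$; $x^{\uparrow};\mathsf a(x)=x^{\uparrow}$; and if $\mathsf d(x);y=\mathsf d(x);y;\mathsf d(x)$ then $\mathsf d(x);y^{\uparrow}=\mathsf d(x);y^{\uparrow};\mathsf d(x)$. A *modal restriction semigroup* is an algebra $(S,;,\mathsf a)$ satisfying (Ass) and (Antidom). **Theorem.** The classes of representable $\{;,\mathsf a,\mathsf r\}$-algebras and of representable $\{;,\cdot,\mathsf a,\mathsf r\}$-algebras are finitely axiomatisable. More precisely: 1. An algebra $(S,;,\mathsf a,\mathsf r)$ is representable if and only if $(S,;,\mathsf a)$ is a modal restriction semigroup and (Ran), (DR) and (Antirange) hold.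 The class of representable algebras is a proper quasivariety: it is axiomatised by a finite set of quasi-identities, but by no set of identities. 2. An algebra $(S,;,\cdot,\mathsf a,\mathsf r)$ is representable if and only if both $(S,;,\cdot,\mathsf a)$ and $(S,;,\cdot,\mathsf d,\mathsf r)$ are representable and (Antirange) holds. The class of representable algebras is axiomatised by (Ass), (Dom), (Meet), (Antidom), (Ran), (DR) and (Antirange), and it is a variety, axiomatised by a finite set of identities. 3. With (Pref) added to the axioms, both axiomatisations extend to the signatures with $\sqcup$ adjoined. With (Iter) added, the axiomatisations (with or without $\sqcup$) characterise the finite representable algebras in the signatures with ${}^{\uparrow}$ adjoined. -/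

import Mathlib

universe u v

namespace FunAlg

open scoped FirstOrder

/-! Similarity types of algebras of partial functions. -/

/-- The operation symbols, indexed by arity: composition `;`, intersection `·`, domain `d`,
antidomain `a`, range `r`, preferential union `⊔` and maximum iterate `↑`. -/
inductive Op : ℕ → Type
  | comp : Op 2
  | meet : Op 2
  | dom : Op 1
  | anti : Op 1
  | ran : Op 1
  | pref : Op 2
  | iter : Op 1

/-- A similarity type is a set of operation symbols. -/
abbrev Sig : Type := Set (Σ n, Op n)

/-- The algebraic first-order language of a similarity type. -/
def lang (τ : Sig) : FirstOrder.Language where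
  Functions n := {o : Op n // (⟨n, o⟩ : Σ n, Op n) ∈ τ}
  Relations _ := Empty

/-- The symbol `o` belongs to the similarity type `τ` (found automatically for concrete `τ`). -/
class Has (τ : Sig) {n : ℕ} (o : Op n) : Prop where
  mem : (⟨n, o⟩ : Σ n, Op n) ∈ τ

instance hasInsertSelf (τ : Sig) {n : ℕ} (o : Op n) : Has (insert ⟨n, o⟩ τ) o :=
  ⟨Set.mem_insert _ _⟩

instance hasInsert (τ : Sig) (p : Σ n, Op n) {n : ℕ} (o : Op n) [h : Has τ o] :
    Has (insert p τ) o :=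
  ⟨Set.mem_insert_of_mem _ h.mem⟩

instance hasSingleton {n : ℕ} (o : Op n) : Has {⟨n, o⟩} o :=
  ⟨Set.mem_singleton _⟩

/-- The binary operation of a `τ`-algebra `S` named by the symbol `o`. -/
def bin (τ : Sig) (o : Op 2) [h : Has τ o] {S : Type u} [(lang τ).Structure S] : S → S → S :=
  fun x y => FirstOrder.Language.Structure.funMap (L := lang τ) ⟨o, h.mem⟩ ![x, y]

/-- The unary operation of a `τ`-algebra `S` named by the symbol `o`. -/
def un (τ : Sig) (o : Op 1) [h : Has τ o] {S : Type u} [(lang τ).Structure S] : S → S :=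
  fun x => FirstOrder.Language.Structure.funMap (L := lang τ) ⟨o, h.mem⟩ ![x]

/-- The similarity type `{;, a, r}`. -/
abbrev sigAR : Sig := {⟨2, Op.comp⟩, ⟨1, Op.anti⟩, ⟨1, Op.ran⟩}

/-- The similarity type `{;, ·, a, r}`. -/
abbrev sigMAR : Sig := {⟨2, Op.comp⟩, ⟨2, Op.meet⟩, ⟨1, Op.anti⟩, ⟨1, Op.ran⟩}

/-- The similarity type `{;, ·, a}`. -/
abbrev sigMA : Sig := {⟨2, Op.comp⟩, ⟨2, Op.meet⟩, ⟨1, Op.anti⟩}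

/-- The similarity type `{;, ·, d, r}`. -/
abbrev sigMDR : Sig := {⟨2, Op.comp⟩, ⟨2, Op.meet⟩, ⟨1, Op.dom⟩, ⟨1, Op.ran⟩}

/-- Adjoin preferential union to a similarity type. -/
abbrev withPref (τ : Sig) : Sig := insert ⟨2, Op.pref⟩ τ

/-- Adjoin maximum iterate to a similarity type. -/
abbrev withIter (τ : Sig) : Sig := insert ⟨1, Op.iter⟩ τ

/-- The `{;, ·, a}`-algebra `(S, c, m, a)`. -/
@[reducible] def algMA {S : Type u} (c m : S → S → S) (a : S → S) : (lang sigMA).Structure S where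
  funMap {n} o xs :=
    match n, o, xs with
    | _, ⟨Op.comp, _⟩, xs => c (xs 0) (xs 1)
    | _, ⟨Op.meet, _⟩, xs => m (xs 0) (xs 1)
    | _, ⟨Op.anti, _⟩, xs => a (xs 0)
    | _, ⟨Op.dom, h⟩, _ => absurd h (by simp)
    | _, ⟨Op.ran, h⟩, _ => absurd h (by simp)
    | _, ⟨Op.pref, h⟩, _ => absurd h (by simp)
    | _, ⟨Op.iter, h⟩, _ => absurd h (by simp)
  RelMap R := R.elim

/-- The `{;, ·, d, r}`-algebra `(S, c, m, d, r)`. -/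
@[reducible] def algMDR {S : Type u} (c m : S → S → S) (d r : S → S) : (lang sigMDR).Structure S where
  funMap {n} o xs :=
    match n, o, xs with
    | _, ⟨Op.comp, _⟩, xs => c (xs 0) (xs 1)
    | _, ⟨Op.meet, _⟩, xs => m (xs 0) (xs 1)
    | _, ⟨Op.dom, _⟩, xs => d (xs 0)
    | _, ⟨Op.ran, _⟩, xs => r (xs 0)
    | _, ⟨Op.anti, h⟩, _ => absurd h (by simp)
    | _, ⟨Op.pref, h⟩, _ => absurd h (by simp)
    | _, ⟨Op.iter, h⟩, _ => absurd h (by simp)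
  RelMap R := R.elim

/-! The operations on partial functions `X → X`. -/

section Concrete

variable {X : Type v}

/-- `f ; g`: first `f`, then `g`. -/
def pcomp (f g : X →. X) : X →. X := g.comp f

/-- The intersection of (the graphs of) `f` and `g`. -/
def pmeet (f g : X →. X) : X →. X := fun x =>
  ⟨∃ (h : (f x).Dom) (k : (g x).Dom), (f x).get h = (g x).get k, fun h => (f x).get h.fst⟩

/-- The identity restricted to the domain of `f`. -/
def pdom (f : X →. X) : X →. X := fun x => ⟨(f x).Dom, fun _ => x⟩

/-- The identity restricted to the complement in `X` of the domain of `f`. -/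
def panti (f : X →. X) : X →. X := fun x => ⟨¬ (f x).Dom, fun _ => x⟩

/-- The identity restricted to the range of `f`. -/
def pran (f : X →. X) : X →. X := fun y => ⟨∃ x, y ∈ f x, fun _ => y⟩

open Classical in
/-- Preferential union: `f x` if this is defined, and `g x` otherwise. -/
noncomputable def ppref (f g : X →. X) : X →. X := fun x => if (f x).Dom then f x else g x

/-- The power `f ^ n` with respect to composition; `f ^ 0` is the identity. -/
def ppow (f : X →. X) : ℕ → (X →. X)
  | 0 => PFun.id X
  | n + 1 => pcomp f (ppow f n)

open Classical in
/-- Preferential union of a sequence: at `x`, the value of the first `F n` defined at `x`. -/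
noncomputable def pprefSeq (F : ℕ → (X →. X)) : X →. X := fun x =>
  ⟨∃ n, (F n x).Dom, fun h => (F (Nat.find h) x).get (Nat.find_spec h)⟩

/-- Maximum iterate: the preferential union of all `f ^ n ; a(f)`. -/
noncomputable def piter (f : X →. X) : X →. X :=
  pprefSeq fun n => pcomp (ppow f n) (panti f)

/-- The `τ`-algebra of all partial functions on `X`. -/
noncomputable instance partialFunctions (τ : Sig) (X : Type v) : (lang τ).Structure (X →. X) where
  funMap {n} o fs :=
    match n, o.1, fs with
    | _, Op.comp, fs => pcomp (fs 0) (fs 1)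
    | _, Op.meet, fs => pmeet (fs 0) (fs 1)
    | _, Op.dom, fs => pdom (fs 0)
    | _, Op.anti, fs => panti (fs 0)
    | _, Op.ran, fs => pran (fs 0)
    | _, Op.pref, fs => ppref (fs 0) (fs 1)
    | _, Op.iter, fs => piter (fs 0)
  RelMap R := R.elim

end Concrete

/-- A `τ`-algebra is representable if it is isomorphic to a `τ`-algebra of functions, that is, to
a family of partial functions on some set that is closed under the operations in `τ`. -/
def Representable (τ : Sig) (S : Type u) [(lang τ).Structure S] : Prop :=
  ∃ (X : Type u) (T : (lang τ).Substructure (X →. X)), Nonempty (S ≃[lang τ] T)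

/-! Identities, quasi-identities, varieties and quasivarieties. -/

/-- An identity `s = t` between terms in countably many variables. -/
structure Identity (L : FirstOrder.Language.{0, 0}) where
  lhs : L.Term ℕ
  rhs : L.Term ℕ

/-- The identity is satisfied under the assignment `w`. -/
def Identity.At {L : FirstOrder.Language.{0, 0}} (e : Identity L) {S : Type u} [L.Structure S]
    (w : ℕ → S) : Prop :=
  e.lhs.realize w = e.rhs.realize w

/-- A quasi-identity: a finite list of identities implies an identity. -/
structure QuasiIdentity (L : FirstOrder.Language.{0, 0}) where
  premises : List (Identity L)
  conclusion : Identity L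

/-- The identity holds in `S`. -/
def Identity.Holds {L : FirstOrder.Language.{0, 0}} (e : Identity L) (S : Type u) [L.Structure S] : Prop :=
  ∀ w : ℕ → S, e.At w

/-- The quasi-identity holds in `S`. -/
def QuasiIdentity.Holds {L : FirstOrder.Language.{0, 0}} (q : QuasiIdentity L) (S : Type u)
    [L.Structure S] : Prop :=
  ∀ w : ℕ → S, (∀ e ∈ q.premises, e.At w) → q.conclusion.At w

/-- `K` is the class of all models of the set `E` of identities. -/
def AxiomatisedByIdentities {L : FirstOrder.Language.{0, 0}} (E : Set (Identity L))
    (K : ∀ (S : Type u) [L.Structure S], Prop) : Prop :=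
  ∀ (S : Type u) [L.Structure S], K S ↔ ∀ e ∈ E, e.Holds S

/-- `K` is the class of all models of the set `Q` of quasi-identities. -/
def AxiomatisedByQuasiIdentities {L : FirstOrder.Language.{0, 0}} (Q : Set (QuasiIdentity L))
    (K : ∀ (S : Type u) [L.Structure S], Prop) : Prop :=
  ∀ (S : Type u) [L.Structure S], K S ↔ ∀ q ∈ Q, q.Holds S

/-- A variety: a class of algebras axiomatised by identities. -/
def IsVariety {L : FirstOrder.Language.{0, 0}} (K : ∀ (S : Type u) [L.Structure S], Prop) : Prop :=
  ∃ E : Set (Identity L), AxiomatisedByIdentities E K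

/-- A variety axiomatised by finitely many identities. -/
def IsFinitelyBasedVariety {L : FirstOrder.Language.{0, 0}}
    (K : ∀ (S : Type u) [L.Structure S], Prop) : Prop :=
  ∃ E : Set (Identity L), E.Finite ∧ AxiomatisedByIdentities E K

/-- A quasivariety axiomatised by finitely many quasi-identities. -/
def IsFinitelyBasedQuasivariety {L : FirstOrder.Language.{0, 0}}
    (K : ∀ (S : Type u) [L.Structure S], Prop) : Prop :=
  ∃ Q : Set (QuasiIdentity L), Q.Finite ∧ AxiomatisedByQuasiIdentities Q K

/-! The axioms. Here `c` is composition, `m` intersection, `a` antidomain, `r` range,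
`d` domain, `p` preferential union and `i` maximum iterate. -/

section Axioms

variable {S : Type u}

/-- The derived domain operation `d(x) = a(a(x))`. -/
def derivedDom (a : S → S) (x : S) : S := a (a x)

/-- `x` is a domain element: `d(x) = x`. -/
def IsDomElt (a : S → S) (x : S) : Prop := derivedDom a x = x

/-- The join `α ∨ β = a(a(α) ; a(β))` of domain elements. -/
def join (c : S → S → S) (a : S → S) (x y : S) : S := a (c (a x) (a y))

/-- The antidomain laws, where `0` stands for `a(x) ; x` with any `x`, and `1'` for `a(0)`. -/
structure AntidomainLaws (c : S → S → S) (a : S → S) : Prop where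
  zero : ∀ x y, c (a x) x = c (a y) y
  zero_comp : ∀ x y, c (c (a x) x) y = c (a x) x
  one_comp : ∀ x y, c (a (c (a x) x)) y = y
  comm : ∀ x y, c (a x) (a y) = c (a y) (a x)
  twisted : ∀ x y, c x (a y) = c (a (c x y)) x
  left_union : ∀ α x y, IsDomElt a α →
    c α x = c α y → c (a α) x = c (a α) y → x = y

/-- Modal restriction semigroups. -/
structure IsModalRestrictionSemigroup (c : S → S → S) (a : S → S) : Prop where
  assoc : ∀ x y z, c (c x y) z = c x (c y z)
  antidomain : AntidomainLaws c a

/-- The domain laws of restriction semigroups. -/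
structure DomainLaws (c : S → S → S) (d : S → S) : Prop where
  left_id : ∀ x, c (d x) x = x
  comm : ∀ x y, c (d x) (d y) = c (d y) (d x)
  dom_dom : ∀ x, d (d x) = d x
  order : ∀ x y, c (d x) (d (c x y)) = d (c x y)
  twisted : ∀ x y, c x (d y) = c (d (c x y)) x

/-- The semilattice laws. -/
structure SemilatticeLaws (m : S → S → S) : Prop where
  assoc : ∀ x y z, m (m x y) z = m x (m y z)
  comm : ∀ x y, m x y = m y x
  idem : ∀ x, m x x = x

/-- The laws relating intersection to composition and domain. -/
structure MeetLaws (c m : S → S → S) (d : S → S) : Prop where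
  twisted : ∀ x y z, c x (m y z) = m (c x y) (c x z)
  order : ∀ x y, m x y = c (d (m x y)) x

/-- The range laws. -/
structure RangeLaws (c : S → S → S) (r : S → S) : Prop where
  right_id : ∀ x, c x (r x) = x
  comm : ∀ x y, c (r x) (r y) = c (r y) (r x)
  ran_ran : ∀ x, r (r x) = r x
  order : ∀ x y, c (r (c x y)) (r y) = r (c x y)
  right_cong : ∀ x y, r (c (r x) y) = r (c x y)
  cancel : ∀ x y z, c x y = c x z → c (r x) y = c (r x) z

/-- The domain-range laws. -/
structure DomainRangeLaws (d r : S → S) : Prop where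
  dom_ran : ∀ x, d (r x) = r x
  ran_dom : ∀ x, r (d x) = d x

/-- The antirange law `r(α ; x) ∨ r(β ; x) = r((α ∨ β) ; x)` for domain elements `α`, `β`. -/
def AntirangeLaw (c : S → S → S) (a r : S → S) : Prop :=
  ∀ α β x, IsDomElt a α → IsDomElt a β →
    join c a (r (c α x)) (r (c β x)) = r (c (join c a α β) x)

/-- The axioms for the signature `{;, a, r}`. -/
structure AxiomsAR (c : S → S → S) (a r : S → S) : Prop where
  modal : IsModalRestrictionSemigroup c a
  range : RangeLaws c r
  domainRange : DomainRangeLaws (derivedDom a) r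
  antirange : AntirangeLaw c a r

/-- The axioms for the signature `{;, ·, a, r}`. -/
structure AxiomsMAR (c m : S → S → S) (a r : S → S) : Prop where
  assoc : ∀ x y z, c (c x y) z = c x (c y z)
  domain : DomainLaws c (derivedDom a)
  semilattice : SemilatticeLaws m
  meet : MeetLaws c m (derivedDom a)
  antidomain : AntidomainLaws c a
  range : RangeLaws c r
  domainRange : DomainRangeLaws (derivedDom a) r
  antirange : AntirangeLaw c a r

/-- The laws for preferential union. -/
structure PrefLaws (c : S → S → S) (a : S → S) (p : S → S → S) : Prop where
  dom_pref : ∀ x y, c (derivedDom a x) (p x y) = x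
  anti_pref : ∀ x y, c (a x) (p x y) = c (a x) y

/-- The laws for maximum iterate. -/
structure IterLaws (c : S → S → S) (a i : S → S) : Prop where
  dom_iter : ∀ x, c (derivedDom a x) (i x) = c x (i x)
  anti_iter : ∀ x, c (a x) (i x) = a x
  iter_anti : ∀ x, c (i x) (a x) = i x
  invariant : ∀ x y,
    c (derivedDom a x) y = c (c (derivedDom a x) y) (derivedDom a x) →
      c (derivedDom a x) (i y) = c (c (derivedDom a x) (i y)) (derivedDom a x)

end Axioms

end FunAlg

open FunAlg

/-!
Soundness is a computation with graphs of partial functions. The content is completeness: every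
algebra satisfying the laws for `{;, a, r}` embeds into an algebra of all partial functions, in a
way that respects intersection, preferential union and, in the finite case, maximum iterate.

The domain elements form a Boolean algebra `D`, with `;` as meet and `a` as complement. For an
ultrafilter `U` of `D`, say that `x` and `y` agree on `U` (`EqOn U x y`) if `α ; x = α ; y` for some
`α ∈ U`. Elements modulo agreement on `U`, without the class of `0`, carry a partial action of the
algebra by composition on the right. The union of these actions over all `U` is a faithful
representation of `;` and `a`, but a point in the domain of `r(s)` may fail to be in the range of
`s`. Such preimages are supplied as follows.

If `U` contains `r(s)`, cancellation shows that the elements `d(s ; α)`, `α ∈ U`, lie in a common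
ultrafilter `V` (`IsUltra.exists_preimage`), and cancellation again shows that `x ↦ s ; x` embeds the
elements modulo `U` into the elements modulo `V` (`IsUltra.eqOn_mul_left_iff`). So it suffices to
replace the elements modulo `U` by a larger family of points on which `s` acts as the restriction
along such embeddings. A point over `U` is taken to be an injective labelling `f` of the nonzero
elements modulo `U` by a set with many labels left unused (`IsLabelling`), and `s` sends `f` to
`x ↦ f (s ; x)`. A labelling over `U` extends along the embedding into the elements modulo `V`, using
some of the unused labels, and the extension is a preimage under `s`
(`IsLabelling.exists_preimage`). This gives `AntidomainRangeMonoid.exists_representation`.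

In this representation two elements that agree at a point agree on a domain element fixing that
point, so intersection is preserved. Preferential union is determined by its laws in any
representation. Maximum iterate is determined by its laws at points from which iteration stops; at
the other points finiteness yields a power of `x` whose domain is invariant under `x`, and the
invariance law makes `x↑` undefined there (`IsLocallyFreeRep.iter`).

The representable `{;, a, r}`-algebras are not closed under quotients: in the square of the
two-element group with zero, pairs of group elements can be identified when they have equal
products. With intersection, cancellation and the law of unions become identities, since
`x ; y = x ; z` forces `x ; y = x ; (y · z)`, and all that remains is a comparison of the domains of
`y` and `y · z` (`EquationalLaws.axiomsMAR`).
-/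

namespace FunAlg

/-! ### The laws for partial functions -/

section Concrete

variable {X : Type v}

theorem pfun_ext {f g : X →. X} (h : ∀ x y, y ∈ f x ↔ y ∈ g x) : f = g :=
  funext fun x => Part.ext (h x)

theorem mem_pcomp {f g : X →. X} {x y : X} : y ∈ pcomp f g x ↔ ∃ z, z ∈ f x ∧ y ∈ g z := by
  rw [pcomp, PFun.comp_apply]
  exact Part.mem_bind_iff

theorem mem_pmeet {f g : X →. X} {x y : X} : y ∈ pmeet f g x ↔ y ∈ f x ∧ y ∈ g x := by
  constructor
  · rintro ⟨⟨h, k, e⟩, rfl⟩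
    exact ⟨⟨h, rfl⟩, ⟨k, e.symm⟩⟩
  · rintro ⟨⟨h, rfl⟩, ⟨k, e⟩⟩
    exact ⟨⟨h, k, e.symm⟩, rfl⟩

theorem mem_pdom {f : X →. X} {x y : X} : y ∈ pdom f x ↔ y = x ∧ ∃ z, z ∈ f x := by
  rw [← Part.dom_iff_mem]
  exact ⟨fun ⟨h, e⟩ => ⟨e.symm, h⟩, fun ⟨e, h⟩ => ⟨h, e.symm⟩⟩

theorem mem_panti {f : X →. X} {x y : X} : y ∈ panti f x ↔ y = x ∧ ¬ ∃ z, z ∈ f x := by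
  rw [← Part.dom_iff_mem]
  exact ⟨fun ⟨h, e⟩ => ⟨e.symm, h⟩, fun ⟨e, h⟩ => ⟨h, e.symm⟩⟩

theorem mem_pran {f : X →. X} {x y : X} : y ∈ pran f x ↔ y = x ∧ ∃ z, x ∈ f z :=
  ⟨fun ⟨h, e⟩ => ⟨e.symm, h⟩, fun ⟨e, h⟩ => ⟨h, e.symm⟩⟩

theorem mem_ppref {f g : X →. X} {x y : X} :
    y ∈ ppref f g x ↔ y ∈ f x ∨ (¬ ∃ z, z ∈ f x) ∧ y ∈ g x := by
  rw [← Part.dom_iff_mem]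
  by_cases h : (f x).Dom
  · simp [ppref, h]
  · have : y ∉ f x := fun hy => h (Part.dom_iff_mem.2 ⟨y, hy⟩)
    simp [ppref, h, this]

theorem panti_panti (f : X →. X) : panti (panti f) = pdom f :=
  pfun_ext fun x y => by simp only [mem_panti, mem_pdom]; grind

theorem derivedDom_panti : derivedDom (panti (X := X)) = pdom :=
  funext panti_panti

theorem pcomp_assoc (f g h : X →. X) : pcomp (pcomp f g) h = pcomp f (pcomp g h) :=
  pfun_ext fun x y => by simp only [mem_pcomp]; grind

theorem domainLaws_pdom : DomainLaws (pcomp (X := X)) pdom where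
  left_id f := pfun_ext fun x y => by simp only [mem_pcomp, mem_pdom]; grind
  comm f g := pfun_ext fun x y => by simp only [mem_pcomp, mem_pdom]; grind
  dom_dom f := pfun_ext fun x y => by simp only [mem_pdom]; grind
  order f g := pfun_ext fun x y => by simp only [mem_pcomp, mem_pdom]; grind
  twisted f g := pfun_ext fun x y => by
    simp only [mem_pcomp, mem_pdom]; grind [Part.mem_unique]

theorem semilatticeLaws_pmeet : SemilatticeLaws (pmeet (X := X)) where
  assoc f g h := pfun_ext fun x y => by simp only [mem_pmeet]; grind
  comm f g := pfun_ext fun x y => by simp only [mem_pmeet]; grind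
  idem f := pfun_ext fun x y => by simp only [mem_pmeet]; grind

theorem meetLaws_pmeet : MeetLaws (pcomp (X := X)) pmeet pdom where
  twisted f g h := pfun_ext fun x y => by
    simp only [mem_pcomp, mem_pmeet]; grind [Part.mem_unique]
  order f g := pfun_ext fun x y => by
    simp only [mem_pcomp, mem_pmeet, mem_pdom]; grind [Part.mem_unique]

theorem mem_of_isDomElt {α : X →. X} (hα : IsDomElt panti α) {x y : X} :
    y ∈ α x ↔ y = x ∧ ∃ z, z ∈ α x := by
  have h : pdom α = α := (panti_panti α).symm.trans hα
  rw [← mem_pdom, h]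

theorem antidomainLaws_panti : AntidomainLaws (pcomp (X := X)) panti where
  zero f g := pfun_ext fun x y => by simp only [mem_pcomp, mem_panti]; grind
  zero_comp f g := pfun_ext fun x y => by simp only [mem_pcomp, mem_panti]; grind
  one_comp f g := pfun_ext fun x y => by simp only [mem_pcomp, mem_panti]; grind
  comm f g := pfun_ext fun x y => by simp only [mem_pcomp, mem_panti]; grind
  twisted f g := pfun_ext fun x y => by
    simp only [mem_pcomp, mem_panti]; grind [Part.mem_unique]
  left_union α f g hα h₁ h₂ := pfun_ext fun x y => by
    have k₁ : y ∈ pcomp α f x ↔ y ∈ pcomp α g x := by rw [h₁]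
    have k₂ : y ∈ pcomp (panti α) f x ↔ y ∈ pcomp (panti α) g x := by rw [h₂]
    have := fun y => mem_of_isDomElt hα (x := x) (y := y)
    simp only [mem_pcomp, mem_panti] at k₁ k₂
    grind

theorem rangeLaws_pran : RangeLaws (pcomp (X := X)) pran where
  right_id f := pfun_ext fun x y => by simp only [mem_pcomp, mem_pran]; grind
  comm f g := pfun_ext fun x y => by simp only [mem_pcomp, mem_pran]; grind
  ran_ran f := pfun_ext fun x y => by simp only [mem_pran]; grind
  order f g := pfun_ext fun x y => by simp only [mem_pcomp, mem_pran]; grind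
  right_cong f g := pfun_ext fun x y => by simp only [mem_pcomp, mem_pran]; grind
  cancel f g h e := pfun_ext fun x y => by
    have k : ∀ w, x ∈ f w → (y ∈ g x ↔ y ∈ h x) := fun w hw => by
      have : y ∈ pcomp f g w ↔ y ∈ pcomp f h w := by rw [e]
      simp only [mem_pcomp] at this
      grind [Part.mem_unique]
    simp only [mem_pcomp, mem_pran]
    grind

theorem domainRangeLaws_pdom_pran : DomainRangeLaws (pdom (X := X)) pran where
  dom_ran f := pfun_ext fun x y => by simp only [mem_pdom, mem_pran]; grind
  ran_dom f := pfun_ext fun x y => by simp only [mem_pdom, mem_pran]; grind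

theorem mem_join {f g : X →. X} {x y : X} :
    y ∈ join pcomp panti f g x ↔ y = x ∧ ((∃ z, z ∈ f x) ∨ ∃ z, z ∈ g x) := by
  simp only [join, mem_pcomp, mem_panti]
  refine and_congr_right fun _ => ⟨fun h => ?_, ?_⟩
  · by_contra! h'
    exact h ⟨x, x, ⟨rfl, not_exists.2 h'.1⟩, rfl, not_exists.2 h'.2⟩
  · rintro h ⟨_, _, ⟨rfl, h₁⟩, rfl, h₂⟩
    exact h.elim h₁ h₂

theorem antirangeLaw_pran : AntirangeLaw (pcomp (X := X)) panti pran := by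
  intro α β f hα hβ
  refine pfun_ext fun x y => ?_
  have key : ∀ {γ : X →. X}, (∀ {x y}, y ∈ γ x ↔ y = x ∧ ∃ z, z ∈ γ x) → ∀ x,
      (∃ z, x ∈ pcomp γ f z) ↔ ∃ z, (∃ w, w ∈ γ z) ∧ x ∈ f z := fun {γ} hγ x =>
    exists_congr fun z => by
      rw [mem_pcomp]
      exact ⟨fun ⟨w, hw, hx⟩ => ⟨(hγ.1 hw).2, (hγ.1 hw).1 ▸ hx⟩,
        fun ⟨hw, hx⟩ => ⟨z, hγ.2 ⟨rfl, hw⟩, hx⟩⟩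
  have hj : ∀ {x y}, y ∈ join pcomp panti α β x ↔ y = x ∧ ∃ z, z ∈ join pcomp panti α β x :=
    fun {x y} => by simp only [mem_join]; grind
  rw [mem_join, mem_pran, key hj]
  simp only [mem_pran, mem_join, ← exists_or, exists_eq_left,
    key (mem_of_isDomElt hα), key (mem_of_isDomElt hβ)]
  grind

theorem prefLaws_ppref : PrefLaws (pcomp (X := X)) panti ppref where
  dom_pref f g := pfun_ext fun x y => by
    rw [derivedDom_panti]; simp only [mem_pcomp, mem_pdom, mem_ppref]; grind
  anti_pref f g := pfun_ext fun x y => by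
    simp only [mem_pcomp, mem_panti, mem_ppref]; grind

/-- Preferential union is determined by the two laws. -/
theorem eq_ppref {f g h : X →. X} (h₁ : pcomp (pdom f) h = f)
    (h₂ : pcomp (panti f) h = pcomp (panti f) g) : h = ppref f g := by
  refine pfun_ext fun x y => ?_
  have k₁ : y ∈ pcomp (pdom f) h x ↔ y ∈ f x := by rw [h₁]
  have k₂ : y ∈ pcomp (panti f) h x ↔ y ∈ pcomp (panti f) g x := by rw [h₂]
  simp only [mem_pcomp, mem_panti, mem_pdom, mem_ppref] at k₁ k₂ ⊢
  grind

theorem mem_ppow_zero {f : X →. X} {x y : X} : y ∈ ppow f 0 x ↔ y = x := by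
  simp [ppow, PFun.id]

theorem mem_ppow_succ {f : X →. X} {n : ℕ} {x y : X} :
    y ∈ ppow f (n + 1) x ↔ ∃ z, z ∈ f x ∧ y ∈ ppow f n z := mem_pcomp

/-- An orbit leaves the domain of `f` at most once. -/
theorem ppow_terminal_unique {f : X →. X} {n m : ℕ} {x y y' : X}
    (h : y ∈ ppow f n x) (hy : ¬ ∃ z, z ∈ f y) (h' : y' ∈ ppow f m x)
    (hy' : ¬ ∃ z, z ∈ f y') : y = y' := by
  induction n generalizing m x with
  | zero =>
    cases m with
    | zero => simp only [mem_ppow_zero] at h h'; rw [h, h']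
    | succ m => simp only [mem_ppow_zero, mem_ppow_succ] at h h'; grind
  | succ n ih =>
    obtain ⟨z, hz, h⟩ := mem_ppow_succ.1 h
    cases m with
    | zero => simp only [mem_ppow_zero] at h'; grind
    | succ m =>
      obtain ⟨z', hz', h'⟩ := mem_ppow_succ.1 h'
      obtain rfl := Part.mem_unique hz hz'
      exact ih h h'

theorem mem_piter {f : X →. X} {x y : X} :
    y ∈ piter f x ↔ (∃ n, y ∈ ppow f n x) ∧ ¬ ∃ z, z ∈ f y := by
  have key : ∀ n y, y ∈ pcomp (ppow f n) (panti f) x ↔ y ∈ ppow f n x ∧ ¬ ∃ z, z ∈ f y :=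
    fun n y => by simp only [mem_pcomp, mem_panti]; grind
  classical
  constructor
  · rintro ⟨h, rfl⟩
    have := (key _ _).1 (Part.get_mem (Nat.find_spec h))
    exact ⟨⟨_, this.1⟩, this.2⟩
  · rintro ⟨⟨n, hn⟩, hy⟩
    have h : ∃ n, (pcomp (ppow f n) (panti f) x).Dom :=
      ⟨n, Part.dom_iff_mem.2 ⟨y, (key n y).2 ⟨hn, hy⟩⟩⟩
    have := (key _ _).1 (Part.get_mem (Nat.find_spec h))
    exact ⟨h, (ppow_terminal_unique hn hy this.1 this.2).symm⟩

theorem mem_piter_of_mem {f : X →. X} {x y z : X} (h : z ∈ f x) :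
    y ∈ piter f x ↔ y ∈ piter f z := by
  simp only [mem_piter]
  refine and_congr_left fun hy => ⟨?_, fun ⟨n, hn⟩ => ⟨n + 1, mem_ppow_succ.2 ⟨z, h, hn⟩⟩⟩
  rintro ⟨n, hn⟩
  cases n with
  | zero => rw [mem_ppow_zero.1 hn] at hy; exact absurd ⟨z, h⟩ hy
  | succ n =>
    obtain ⟨z', hz', hn⟩ := mem_ppow_succ.1 hn
    exact ⟨n, Part.mem_unique h hz' ▸ hn⟩

theorem mem_piter_of_not_dom {f : X →. X} {x y : X} (h : ¬ ∃ z, z ∈ f x) :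
    y ∈ piter f x ↔ y = x := by
  rw [mem_piter]
  constructor
  · rintro ⟨⟨n, hn⟩, hy⟩
    exact ppow_terminal_unique hn hy (mem_ppow_zero.2 rfl) h
  · rintro rfl
    exact ⟨⟨0, mem_ppow_zero.2 rfl⟩, h⟩

theorem iterLaws_piter : IterLaws (pcomp (X := X)) panti piter where
  dom_iter f := pfun_ext fun x y => by
    rw [derivedDom_panti]; simp only [mem_pcomp, mem_pdom]; grind [mem_piter_of_mem]
  anti_iter f := pfun_ext fun x y => by
    simp only [mem_pcomp, mem_panti]; grind [mem_piter_of_not_dom]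
  iter_anti f := pfun_ext fun x y => by
    simp only [mem_pcomp, mem_panti]; grind [mem_piter]
  invariant f g h := pfun_ext fun x y => by
    rw [derivedDom_panti] at h ⊢
    have stay : ∀ x y, (∃ z, z ∈ f x) → y ∈ g x → ∃ z, z ∈ f y := fun x y hx hy => by
      have k : y ∈ pcomp (pdom f) g x ↔ y ∈ pcomp (pcomp (pdom f) g) (pdom f) x := by rw [← h]
      simp only [mem_pcomp, mem_pdom] at k
      grind
    have stays : ∀ n x y, (∃ z, z ∈ f x) → y ∈ ppow g n x → ∃ z, z ∈ f y := by
      intro n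
      induction n with
      | zero => intro x y hx hy; rwa [mem_ppow_zero.1 hy]
      | succ n ih =>
        intro x y hx hy
        obtain ⟨z, hz, hy⟩ := mem_ppow_succ.1 hy
        exact ih z y (stay x z hx hz) hy
    have k : ∀ x y, (∃ z, z ∈ f x) → y ∈ piter g x → ∃ z, z ∈ f y := fun x y hx hy => by
      obtain ⟨⟨n, hn⟩, -⟩ := mem_piter.1 hy
      exact stays n x y hx hn
    simp only [mem_pcomp, mem_pdom]
    constructor
    · rintro ⟨_, ⟨rfl, hx⟩, hy⟩
      exact ⟨y, ⟨_, ⟨rfl, hx⟩, hy⟩, rfl, k _ _ hx hy⟩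
    · rintro ⟨_, ⟨z, hz, hy⟩, rfl, -⟩
      exact ⟨z, hz, hy⟩

/-- A partial function obeying the first two laws of maximum iterate that is undefined wherever
`f` can be iterated for ever is the maximum iterate of `f`. -/
theorem eq_piter {f h : X →. X} (h₁ : pcomp (pdom f) h = pcomp f h)
    (h₂ : pcomp (panti f) h = panti f)
    (h₃ : ∀ x y, (∀ n, ∃ z, z ∈ ppow f n x) → y ∉ h x) : h = piter f := by
  have step : ∀ x y z, z ∈ f x → (y ∈ h x ↔ y ∈ h z) := fun x y z hz => by
    have k : y ∈ pcomp (pdom f) h x ↔ y ∈ pcomp f h x := by rw [h₁]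
    simp only [mem_pcomp, mem_pdom] at k
    grind [Part.mem_unique]
  have halt : ∀ x y, (¬ ∃ z, z ∈ f x) → (y ∈ h x ↔ y = x) := fun x y hx => by
    have k : y ∈ pcomp (panti f) h x ↔ y ∈ panti f x := by rw [h₂]
    simp only [mem_pcomp, mem_panti] at k
    grind
  have agree : ∀ n x y z, z ∈ ppow f n x → (¬ ∃ w, w ∈ f z) → (y ∈ h x ↔ y = z) := by
    intro n
    induction n with
    | zero => intro x y z hz hzf; rw [mem_ppow_zero.1 hz] at hzf ⊢; exact halt x y hzf
    | succ n ih =>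
      intro x y z hz hzf
      obtain ⟨w, hw, hz⟩ := mem_ppow_succ.1 hz
      exact (step x y w hw).trans (ih w y z hz hzf)
  have snoc : ∀ n x z w, z ∈ ppow f n x → w ∈ f z → w ∈ ppow f (n + 1) x := by
    intro n
    induction n with
    | zero =>
      intro x z w hz hw
      rw [mem_ppow_zero.1 hz] at hw
      exact mem_ppow_succ.2 ⟨w, hw, mem_ppow_zero.2 rfl⟩
    | succ n ih =>
      intro x z w hz hw
      obtain ⟨t, ht, hz⟩ := mem_ppow_succ.1 hz
      exact mem_ppow_succ.2 ⟨t, ht, ih t z w hz hw⟩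
  refine pfun_ext fun x y => ?_
  by_cases hx : ∃ n z, z ∈ ppow f n x ∧ ¬ ∃ w, w ∈ f z
  · obtain ⟨n, z, hz, hzf⟩ := hx
    rw [agree n x y z hz hzf, mem_piter]
    constructor
    · rintro rfl
      exact ⟨⟨n, hz⟩, hzf⟩
    · rintro ⟨⟨m, hm⟩, hy⟩
      exact ppow_terminal_unique hm hy hz hzf
  · refine iff_of_false (h₃ x y fun n => ?_) fun hy => hx ?_
    · induction n with
      | zero => exact ⟨x, mem_ppow_zero.2 rfl⟩
      | succ n ih =>
        obtain ⟨z, hz⟩ := ih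
        by_cases hzf : ∃ w, w ∈ f z
        · exact hzf.imp fun w hw => snoc n x z w hz hw
        · exact absurd ⟨n, z, hz, hzf⟩ hx
    · obtain ⟨⟨n, hn⟩, hy⟩ := mem_piter.1 hy
      exact ⟨n, y, hn, hy⟩

end Concrete

/-! ### Laws pulled back along injective homomorphisms -/

section Pullback

variable {S : Type u} {T : Type v} {φ : S → T} {c m p : S → S → S} {a d r i : S → S}
  {c' m' p' : T → T → T} {a' d' r' i' : T → T}

theorem map_derivedDom (ha : ∀ x, φ (a x) = a' (φ x)) (x : S) :
    φ (derivedDom a x) = derivedDom a' (φ x) := by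
  simp only [derivedDom, ha]

theorem IsDomElt.map (ha : ∀ x, φ (a x) = a' (φ x)) {α : S} (h : IsDomElt a α) :
    IsDomElt a' (φ α) := by
  rw [IsDomElt, ← map_derivedDom ha, h]

theorem assoc_pullback (hφ : Function.Injective φ) (hc : ∀ x y, φ (c x y) = c' (φ x) (φ y))
    (h : ∀ x y z, c' (c' x y) z = c' x (c' y z)) (x y z : S) :
    c (c x y) z = c x (c y z) :=
  hφ (by simp only [hc, h])

theorem DomainLaws.pullback (hφ : Function.Injective φ) (hc : ∀ x y, φ (c x y) = c' (φ x) (φ y))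
    (hd : ∀ x, φ (d x) = d' (φ x)) (h : DomainLaws c' d') : DomainLaws c d where
  left_id x := hφ (by simpa only [hc, hd] using h.left_id _)
  comm x y := hφ (by simpa only [hc, hd] using h.comm _ _)
  dom_dom x := hφ (by simpa only [hc, hd] using h.dom_dom _)
  order x y := hφ (by simpa only [hc, hd] using h.order _ _)
  twisted x y := hφ (by simpa only [hc, hd] using h.twisted _ _)

theorem SemilatticeLaws.pullback (hφ : Function.Injective φ)
    (hm : ∀ x y, φ (m x y) = m' (φ x) (φ y)) (h : SemilatticeLaws m') : SemilatticeLaws m where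
  assoc x y z := hφ (by simpa only [hm] using h.assoc _ _ _)
  comm x y := hφ (by simpa only [hm] using h.comm _ _)
  idem x := hφ (by simpa only [hm] using h.idem _)

theorem MeetLaws.pullback (hφ : Function.Injective φ) (hc : ∀ x y, φ (c x y) = c' (φ x) (φ y))
    (hm : ∀ x y, φ (m x y) = m' (φ x) (φ y)) (hd : ∀ x, φ (d x) = d' (φ x))
    (h : MeetLaws c' m' d') : MeetLaws c m d where
  twisted x y z := hφ (by simpa only [hc, hm] using h.twisted _ _ _)
  order x y := hφ (by simpa only [hc, hm, hd] using h.order _ _)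

theorem AntidomainLaws.pullback (hφ : Function.Injective φ)
    (hc : ∀ x y, φ (c x y) = c' (φ x) (φ y)) (ha : ∀ x, φ (a x) = a' (φ x))
    (h : AntidomainLaws c' a') : AntidomainLaws c a where
  zero x y := hφ (by simpa only [hc, ha] using h.zero _ _)
  zero_comp x y := hφ (by simpa only [hc, ha] using h.zero_comp _ _)
  one_comp x y := hφ (by simpa only [hc, ha] using h.one_comp _ _)
  comm x y := hφ (by simpa only [hc, ha] using h.comm _ _)
  twisted x y := hφ (by simpa only [hc, ha] using h.twisted _ _)
  left_union α x y hα h₁ h₂ := hφ (h.left_union (φ α) _ _ (hα.map ha)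
    (by simpa only [hc] using congrArg φ h₁) (by simpa only [hc, ha] using congrArg φ h₂))

theorem RangeLaws.pullback (hφ : Function.Injective φ) (hc : ∀ x y, φ (c x y) = c' (φ x) (φ y))
    (hr : ∀ x, φ (r x) = r' (φ x)) (h : RangeLaws c' r') : RangeLaws c r where
  right_id x := hφ (by simpa only [hc, hr] using h.right_id _)
  comm x y := hφ (by simpa only [hc, hr] using h.comm _ _)
  ran_ran x := hφ (by simpa only [hc, hr] using h.ran_ran _)
  order x y := hφ (by simpa only [hc, hr] using h.order _ _)
  right_cong x y := hφ (by simpa only [hc, hr] using h.right_cong _ _)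
  cancel x y z e := hφ (by
    simpa only [hc, hr] using h.cancel _ _ _ (by simpa only [hc] using congrArg φ e))

theorem DomainRangeLaws.pullback (hφ : Function.Injective φ) (hd : ∀ x, φ (d x) = d' (φ x))
    (hr : ∀ x, φ (r x) = r' (φ x)) (h : DomainRangeLaws d' r') : DomainRangeLaws d r where
  dom_ran x := hφ (by simpa only [hd, hr] using h.dom_ran _)
  ran_dom x := hφ (by simpa only [hd, hr] using h.ran_dom _)

theorem AntirangeLaw.pullback (hφ : Function.Injective φ)
    (hc : ∀ x y, φ (c x y) = c' (φ x) (φ y)) (ha : ∀ x, φ (a x) = a' (φ x))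
    (hr : ∀ x, φ (r x) = r' (φ x)) (h : AntirangeLaw c' a' r') : AntirangeLaw c a r :=
  fun α β x hα hβ => hφ (by
    simpa only [join, hc, ha, hr] using h (φ α) (φ β) (φ x) (hα.map ha) (hβ.map ha))

theorem AxiomsAR.pullback (hφ : Function.Injective φ) (hc : ∀ x y, φ (c x y) = c' (φ x) (φ y))
    (ha : ∀ x, φ (a x) = a' (φ x)) (hr : ∀ x, φ (r x) = r' (φ x)) (h : AxiomsAR c' a' r') :
    AxiomsAR c a r where
  modal := ⟨assoc_pullback hφ hc h.modal.assoc, h.modal.antidomain.pullback hφ hc ha⟩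
  range := h.range.pullback hφ hc hr
  domainRange := h.domainRange.pullback hφ (map_derivedDom ha) hr
  antirange := h.antirange.pullback hφ hc ha hr

theorem AxiomsMAR.pullback (hφ : Function.Injective φ) (hc : ∀ x y, φ (c x y) = c' (φ x) (φ y))
    (hm : ∀ x y, φ (m x y) = m' (φ x) (φ y))
    (ha : ∀ x, φ (a x) = a' (φ x)) (hr : ∀ x, φ (r x) = r' (φ x)) (h : AxiomsMAR c' m' a' r') :
    AxiomsMAR c m a r where
  assoc := assoc_pullback hφ hc h.assoc
  domain := h.domain.pullback hφ hc (map_derivedDom ha)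
  semilattice := h.semilattice.pullback hφ hm
  meet := h.meet.pullback hφ hc hm (map_derivedDom ha)
  antidomain := h.antidomain.pullback hφ hc ha
  range := h.range.pullback hφ hc hr
  domainRange := h.domainRange.pullback hφ (map_derivedDom ha) hr
  antirange := h.antirange.pullback hφ hc ha hr

theorem PrefLaws.pullback (hφ : Function.Injective φ) (hc : ∀ x y, φ (c x y) = c' (φ x) (φ y))
    (ha : ∀ x, φ (a x) = a' (φ x)) (hp : ∀ x y, φ (p x y) = p' (φ x) (φ y))
    (h : PrefLaws c' a' p') : PrefLaws c a p where
  dom_pref x y := hφ (by simpa only [hc, map_derivedDom ha, hp] using h.dom_pref _ _)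
  anti_pref x y := hφ (by simpa only [hc, ha, hp] using h.anti_pref _ _)

theorem IterLaws.pullback (hφ : Function.Injective φ) (hc : ∀ x y, φ (c x y) = c' (φ x) (φ y))
    (ha : ∀ x, φ (a x) = a' (φ x)) (hi : ∀ x, φ (i x) = i' (φ x))
    (h : IterLaws c' a' i') : IterLaws c a i where
  dom_iter x := hφ (by simpa only [hc, map_derivedDom ha, hi] using h.dom_iter _)
  anti_iter x := hφ (by simpa only [hc, ha, hi] using h.anti_iter _)
  iter_anti x := hφ (by simpa only [hc, ha, hi] using h.iter_anti _)
  invariant x y e := hφ (by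
    simpa only [hc, map_derivedDom ha, hi] using h.invariant (φ x) (φ y)
      (by simpa only [hc, map_derivedDom ha] using congrArg φ e))

end Pullback

theorem AxiomsMAR.toAxiomsAR {S : Type u} {c m : S → S → S} {a r : S → S}
    (h : AxiomsMAR c m a r) : AxiomsAR c a r :=
  ⟨⟨h.assoc, h.antidomain⟩, h.range, h.domainRange, h.antirange⟩

theorem axiomsMAR_partialFunctions (X : Type v) :
    AxiomsMAR (pcomp (X := X)) pmeet panti pran where
  assoc := pcomp_assoc
  domain := derivedDom_panti (X := X) ▸ domainLaws_pdom
  semilattice := semilatticeLaws_pmeet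
  meet := derivedDom_panti (X := X) ▸ meetLaws_pmeet
  antidomain := antidomainLaws_panti
  range := rangeLaws_pran
  domainRange := derivedDom_panti (X := X) ▸ domainRangeLaws_pdom_pran
  antirange := antirangeLaw_pran

/-! ### Algebra of domain elements -/

/-- The consequences of the axioms for `{;, a, r}` on which the representation rests. Composition
is written multiplicatively, `0` is the common value of `a(x) ; x`, and `1` is `1'`. Domain
elements are the `α` with `ant (ant α) = α`. -/
class AntidomainRangeMonoid (S : Type u) extends MonoidWithZero S where
  ant : S → S
  ran : S → S
  ant_mul_self : ∀ x, ant x * x = 0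
  ant_zero : ant 0 = 1
  ant_comm : ∀ x y, ant x * ant y = ant y * ant x
  mul_ant : ∀ x y, x * ant y = ant (x * y) * x
  ant_ant_ant : ∀ x, ant (ant (ant x)) = ant x
  ext_ant : ∀ u x y, ant u * x = ant u * y → ant (ant u) * x = ant (ant u) * y → x = y
  mul_ran : ∀ x, x * ran x = x
  ant_ant_ran : ∀ x, ant (ant (ran x)) = ran x
  ran_cancel : ∀ x y z, x * y = x * z → ran x * y = ran x * z

/-- The laws of `{;, a, r}` yield the structure above once `0` can be named. The range laws are
needed even for `a(a(a(x))) = a(x)`: for the idempotent `e = a(x)`, cancellation in `e ; e = e ; 1'`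
gives `r(e) = r(e) ; e = e`, and `r(e)` is a domain element. -/
abbrev AxiomsAR.toAntidomainRangeMonoid {S : Type u} {c : S → S → S} {a r : S → S}
    (h : AxiomsAR c a r) (w : S) : AntidomainRangeMonoid S :=
  have zero : ∀ x, c (a x) x = c (a w) w := fun x => h.modal.antidomain.zero x w
  have zero_mul : ∀ x, c (c (a w) w) x = c (a w) w := h.modal.antidomain.zero_comp w
  have one_mul : ∀ x, c (a (c (a w) w)) x = x := h.modal.antidomain.one_comp w
  have mul_zero : ∀ x, c x (c (a w) w) = c (a w) w := fun x => by
    rw [← h.modal.assoc, h.modal.antidomain.twisted, h.modal.assoc, zero]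
  have mul_one : ∀ x, c x (a (c (a w) w)) = x := fun x => by
    rw [h.modal.antidomain.twisted, mul_zero, one_mul]
  have ant_idem : ∀ x, c (a x) (a x) = a x := fun x => by
    rw [h.modal.antidomain.twisted, zero, one_mul]
  have ran_ant : ∀ x, r (a x) = a x := fun x => by
    have h₁ : c (r (a x)) (a x) = r (a x) := by
      rw [h.range.cancel (a x) (a x) (a (c (a w) w)) (by rw [ant_idem, mul_one]), mul_one]
    have h₂ : a (a (r (a x))) = r (a x) := h.domainRange.dom_ran (a x)
    rw [← h₁, ← h₂, h.modal.antidomain.comm, h₂, h.range.right_id]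
  have ant_ant_ant : ∀ x, a (a (a x)) = a x := fun x => by
    have := h.domainRange.dom_ran (a x)
    rwa [ran_ant] at this
  { mul := c
    mul_assoc := h.modal.assoc
    zero := c (a w) w
    one := a (c (a w) w)
    zero_mul := zero_mul
    mul_zero := mul_zero
    one_mul := one_mul
    mul_one := mul_one
    ant := a
    ran := r
    ant_mul_self := zero
    ant_zero := rfl
    ant_comm := h.modal.antidomain.comm
    mul_ant := h.modal.antidomain.twisted
    ant_ant_ant := ant_ant_ant
    ext_ant := fun u x y => h.modal.antidomain.left_union (a u) x y (ant_ant_ant u)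
    mul_ran := h.range.right_id
    ant_ant_ran := h.domainRange.dom_ran
    ran_cancel := h.range.cancel }

namespace AntidomainRangeMonoid

variable {S : Type u} [AntidomainRangeMonoid S]

theorem ant_one : ant (1 : S) = 0 := by
  simpa using ant_mul_self (1 : S)

theorem dom_comm {α β : S} (hα : ant (ant α) = α) (hβ : ant (ant β) = β) : α * β = β * α := by
  rw [← hα, ← hβ, ant_comm]

theorem ant_idem (x : S) : ant x * ant x = ant x := by
  rw [mul_ant, ant_mul_self, ant_zero, one_mul]

theorem dom_idem {α : S} (hα : ant (ant α) = α) : α * α = α := by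
  rw [← hα, ant_idem]

theorem ant_dom_mul (x : S) : ant x * ant (ant x) = 0 := by
  rw [ant_comm, ant_mul_self]

theorem dom_mul_self (x : S) : ant (ant x) * x = x := by
  refine ext_ant x _ _ ?_ ?_
  · rw [← mul_assoc, ant_dom_mul, zero_mul, ant_mul_self]
  · rw [← mul_assoc, ant_idem]

theorem mul_ant_of_mul_eq_zero {w x : S} (h : w * x = 0) : w * ant x = w := by
  rw [mul_ant, h, ant_zero, one_mul]

/-- Domain elements are closed under composition: cancelling `e` in `e ; e = e ; 1'` shows that
`e = r(e)` for every idempotent `e` that commutes with the domain element `r(e)`. -/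
theorem dom_mul {α β : S} (hα : ant (ant α) = α) (hβ : ant (ant β) = β) :
    ant (ant (α * β)) = α * β := by
  have he : α * β * (α * β) = α * β * 1 := by
    rw [mul_assoc, ← mul_assoc β, dom_comm hβ hα, mul_assoc, dom_idem hβ, ← mul_assoc,
      dom_idem hα, mul_one]
  have hr : ran (α * β) = α * β := by
    have h := ran_cancel _ _ _ he
    have hd := ant_ant_ran (α * β)
    rw [mul_one, ← mul_assoc, dom_comm hd hα, mul_assoc, dom_comm hd hβ, ← mul_assoc,
      mul_ran] at h
    exact h.symm
  rw [← hr, ant_ant_ran]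

/-- The twisted law for domain elements. -/
theorem mul_dom (x : S) {α : S} (hα : ant (ant α) = α) : x * α = ant (ant (x * α)) * x := by
  -- `y` is killed by `a(α)`, so `y = y ; α`.
  set y := ant (ant (x * α)) * x with hy
  have h₀ : y * ant α = 0 := by
    rw [hy, mul_assoc, mul_ant, ← mul_assoc, ant_mul_self, zero_mul]
  have h₁ : y * α = y := by
    have := mul_ant_of_mul_eq_zero h₀
    rwa [hα] at this
  rw [← h₁, hy, mul_assoc, dom_mul_self]

end AntidomainRangeMonoid

open AntidomainRangeMonoid

/-! ### Ultrafilters of domain elements -/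

/-- An ultrafilter of the Boolean algebra of domain elements, whose meet is composition and whose
complement is antidomain. Upward closure follows from the other conditions. -/
structure IsUltra {S : Type u} [AntidomainRangeMonoid S] (U : Set S) : Prop where
  dom : ∀ α ∈ U, ant (ant α) = α
  mul_mem : ∀ α ∈ U, ∀ β ∈ U, α * β ∈ U
  zero_notMem : (0 : S) ∉ U
  ant_or : ∀ x, ant x ∈ U ∨ ant (ant x) ∈ U

/-- `x` and `y` agree on some member of `U`. -/
def EqOn {S : Type u} [AntidomainRangeMonoid S] (U : Set S) (x y : S) : Prop :=
  ∃ α ∈ U, α * x = α * y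

section Ultrafilters

variable {S : Type u} [AntidomainRangeMonoid S]

/-- Every filter base of nonzero domain elements extends to an ultrafilter. -/
theorem exists_isUltra {T : Set S} (hne : T.Nonempty) (hdom : ∀ α ∈ T, ant (ant α) = α)
    (hmul : ∀ α ∈ T, ∀ β ∈ T, α * β ∈ T) (hzero : (0 : S) ∉ T) : ∃ U, IsUltra U ∧ T ⊆ U := by
  let F : Set (Set S) := {T | T.Nonempty ∧ (∀ α ∈ T, ant (ant α) = α) ∧
    (∀ α ∈ T, ∀ β ∈ T, α * β ∈ T) ∧ (0 : S) ∉ T}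
  obtain ⟨U, hTU, hU⟩ := zorn_subset_nonempty F (by
    intro C hC hchain ⟨T₀, hT₀⟩
    refine ⟨⋃₀ C, ⟨?_, ?_, ?_, ?_⟩, fun s hs => Set.subset_sUnion_of_mem hs⟩
    · obtain ⟨t, ht⟩ := (hC hT₀).1
      exact ⟨t, T₀, hT₀, ht⟩
    · rintro α ⟨T, hT, hα⟩
      exact (hC hT).2.1 α hα
    · rintro α ⟨T₁, hT₁, hα⟩ β ⟨T₂, hT₂, hβ⟩
      rcases hchain.total hT₁ hT₂ with h | h
      · exact ⟨T₂, hT₂, (hC hT₂).2.2.1 α (h hα) β hβ⟩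
      · exact ⟨T₁, hT₁, (hC hT₁).2.2.1 α hα β (h hβ)⟩
    · rintro ⟨T, hT, h⟩
      exact (hC hT).2.2.2 h) T ⟨hne, hdom, hmul, hzero⟩
  obtain ⟨⟨⟨t₀, ht₀⟩, hUdom, hUmul, hUzero⟩, hmax⟩ := hU
  -- A domain element disjoint from no member of `U` belongs to `U`.
  have key : ∀ α : S, ant (ant α) = α → (∀ t ∈ U, t * α ≠ 0) → α ∈ U := by
    intro α hα h
    have hU' : {γ : S | ant (ant γ) = γ ∧ ∃ t ∈ U, t * α * γ = t * α} ∈ F := by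
      refine ⟨⟨α, hα, t₀, ht₀, by rw [mul_assoc, dom_idem hα]⟩, fun γ hγ => hγ.1, ?_, ?_⟩
      · rintro γ ⟨hγ, t, ht, e⟩ δ ⟨hδ, s, hs, k⟩
        refine ⟨dom_mul hγ hδ, s * t, hUmul s hs t ht, ?_⟩
        rw [mul_assoc s t, ← mul_assoc, mul_assoc s, e, ← mul_assoc,
          dom_comm (hUdom s hs) (hUdom t ht), mul_assoc t s, mul_assoc t, k]
      · rintro ⟨-, t, ht, e⟩
        exact h t ht (by rw [← e, mul_zero])
    refine hmax hU' (fun t ht => ⟨hUdom t ht, t, ht, ?_⟩) ⟨hα, t₀, ht₀, ?_⟩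
    · rw [mul_assoc, dom_comm hα (hUdom t ht), ← mul_assoc, dom_idem (hUdom t ht)]
    · rw [mul_assoc, dom_idem hα]
  refine ⟨U, ⟨hUdom, hUmul, hUzero, fun x => ?_⟩, hTU⟩
  by_contra! hx
  have h₁ : ∃ t ∈ U, t * ant x = 0 := by
    by_contra! h
    exact hx.1 (key _ (ant_ant_ant x) h)
  have h₂ : ∃ t ∈ U, t * ant (ant x) = 0 := by
    by_contra! h
    exact hx.2 (key _ (ant_ant_ant _) h)
  obtain ⟨t, ht, e⟩ := h₁
  obtain ⟨s, hs, k⟩ := h₂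
  have hts : t * s = 0 := by
    refine ext_ant x _ _ ?_ ?_
    · rw [← mul_assoc, dom_comm (ant_ant_ant x) (hUdom t ht), e, zero_mul, mul_zero]
    · rw [dom_comm (hUdom t ht) (hUdom s hs), ← mul_assoc,
        dom_comm (ant_ant_ant _) (hUdom s hs), k, zero_mul, mul_zero]
  exact hUzero (hts ▸ hUmul t ht s hs)

namespace IsUltra

variable {U : Set S}

theorem one_mem (hU : IsUltra U) : (1 : S) ∈ U := by
  rcases hU.ant_or 0 with h | h
  · rwa [ant_zero] at h
  · rw [ant_zero, ant_one] at h
    exact absurd h hU.zero_notMem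

theorem dom_mem_iff (hU : IsUltra U) {x : S} : ant (ant x) ∈ U ↔ ∀ α ∈ U, α * x ≠ 0 := by
  constructor
  · intro h α hα e
    have : α * ant (ant x) = 0 := by
      rw [← mul_ant_of_mul_eq_zero e, mul_assoc, ant_dom_mul, mul_zero]
    exact hU.zero_notMem (this ▸ hU.mul_mem α hα _ h)
  · intro h
    exact (hU.ant_or x).resolve_left fun hx => h _ hx (ant_mul_self x)

theorem ant_mem_iff (hU : IsUltra U) {x : S} : ant x ∈ U ↔ ¬ ant (ant x) ∈ U := by
  refine ⟨fun h h' => hU.zero_notMem ?_, (hU.ant_or x).resolve_right⟩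
  rw [← ant_dom_mul x]
  exact hU.mul_mem _ h _ h'

theorem eqOn_zero_iff (hU : IsUltra U) {x : S} : EqOn U x 0 ↔ ¬ ant (ant x) ∈ U := by
  rw [hU.dom_mem_iff]
  simp [EqOn]

theorem eqOn_refl (hU : IsUltra U) (x : S) : EqOn U x x := ⟨1, hU.one_mem, rfl⟩

theorem _root_.FunAlg.EqOn.symm {x y : S} (h : EqOn U x y) : EqOn U y x :=
  h.imp fun _ h => ⟨h.1, h.2.symm⟩

theorem eqOn_trans (hU : IsUltra U) {x y z : S} (h : EqOn U x y) (h' : EqOn U y z) : EqOn U x z := by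
  obtain ⟨α, hα, e⟩ := h
  obtain ⟨β, hβ, k⟩ := h'
  refine ⟨α * β, hU.mul_mem α hα β hβ, ?_⟩
  rw [mul_assoc α β z, ← k, dom_comm (hU.dom α hα) (hU.dom β hβ), mul_assoc, e, ← mul_assoc,
    ← dom_comm (hU.dom α hα) (hU.dom β hβ), mul_assoc]

/-- If `dom(s ; α) ∈ V` for all `α ∈ U`, then composing with `s` on the left embeds the elements
modulo `U` into the elements modulo `V`. This is where the cancellation law of range enters. -/
theorem eqOn_mul_left_iff {V : Set S} {s : S} (hU : IsUltra U) (hV : IsUltra V)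
    (H : ∀ α ∈ U, ant (ant (s * α)) ∈ V) {x y : S} : EqOn V (s * x) (s * y) ↔ EqOn U x y := by
  constructor
  · rintro ⟨β, hβ, e⟩
    refine ⟨ran (β * s), ?_, ran_cancel _ _ _ (by rw [mul_assoc, e, mul_assoc])⟩
    have h : ¬ ant (ran (β * s)) ∈ U := by
      intro h
      refine hV.dom_mem_iff.1 (H _ h) β hβ ?_
      rw [← mul_assoc]
      nth_rw 1 [← mul_ran (β * s)]
      rw [mul_assoc, ← ant_ant_ran (β * s), ant_ant_ant, ant_mul_self, mul_zero]
    have := (hU.ant_or (ran (β * s))).resolve_left h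
    rwa [ant_ant_ran] at this
  · rintro ⟨α, hα, e⟩
    refine ⟨_, H α hα, ?_⟩
    rw [← mul_assoc, ← mul_dom s (hU.dom α hα), mul_assoc, e, ← mul_assoc, ← mul_assoc,
      ← mul_dom s (hU.dom α hα)]

/-- The image of an ultrafilter under `s`, where `s` is defined. -/
theorem exists_image (hU : IsUltra U) {s : S} (hs : ant (ant s) ∈ U) :
    ∃ W, IsUltra W ∧ ∀ α ∈ W, ant (ant (s * α)) ∈ U := by
  refine ⟨{α | ant (ant α) = α ∧ ant (ant (s * α)) ∈ U}, ⟨fun α h => h.1, ?_, ?_, ?_⟩,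
    fun α h => h.2⟩
  · rintro α ⟨hα, h⟩ β ⟨hβ, k⟩
    refine ⟨dom_mul hα hβ, (hU.ant_or _).resolve_left fun h' => ?_⟩
    refine hU.dom_mem_iff.1 hs _ (hU.mul_mem _ h' _ (hU.mul_mem _ h _ k)) ?_
    rw [mul_assoc, mul_assoc, ← mul_dom s hβ, ← mul_assoc (ant (ant (s * α))), ← mul_dom s hα,
      ← mul_assoc s, ant_mul_self]
  · rintro ⟨-, h⟩
    rw [mul_zero, ant_zero, ant_one] at h
    exact hU.zero_notMem h
  · intro x
    by_contra! h
    have h₁ : ant (s * ant x) ∈ U :=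
      (hU.ant_or _).resolve_right fun h' => h.1 ⟨ant_ant_ant x, h'⟩
    have h₂ : ant (s * ant (ant x)) ∈ U :=
      (hU.ant_or _).resolve_right fun h' => h.2 ⟨ant_ant_ant _, h'⟩
    refine hU.dom_mem_iff.1 hs _ (hU.mul_mem _ h₁ _ h₂) ?_
    rw [mul_assoc, ← mul_ant s (ant (ant x)), ant_ant_ant, ant_mul_self]

/-- An ultrafilter containing `r(s)` is the image under `s` of some ultrafilter. -/
theorem exists_preimage (hU : IsUltra U) {s : S} (hs : ran s ∈ U) :
    ∃ V, IsUltra V ∧ ∀ α ∈ U, ant (ant (s * α)) ∈ V := by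
  -- The upper bounds of the elements `d(s ; α)`. None of them is `0`, by cancellation in
  -- `s ; α = s ; 0`.
  obtain ⟨V, hV, hTV⟩ := exists_isUltra
    (T := {γ : S | ant (ant γ) = γ ∧ ∃ α ∈ U, γ * (s * α) = s * α})
    ⟨1, by rw [ant_one, ant_zero], 1, hU.one_mem, one_mul _⟩ (fun γ h => h.1)
    (by
      rintro γ ⟨hγ, α, hα, e⟩ δ ⟨hδ, β, hβ, k⟩
      refine ⟨dom_mul hγ hδ, α * β, hU.mul_mem α hα β hβ, ?_⟩
      rw [dom_comm hγ hδ, mul_assoc, ← mul_assoc s, ← mul_assoc γ, e, mul_assoc s,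
        dom_comm (hU.dom α hα) (hU.dom β hβ), ← mul_assoc s, ← mul_assoc, k])
    (by
      rintro ⟨-, α, hα, e⟩
      have := ran_cancel s α 0 (by rw [← e, zero_mul, mul_zero])
      rw [mul_zero] at this
      exact hU.zero_notMem (this ▸ hU.mul_mem _ hs α hα))
  exact ⟨V, hV, fun α hα => hTV ⟨ant_ant_ant _, α, hα, dom_mul_self _⟩⟩

end IsUltra

/-- Distinct elements are distinguished by some ultrafilter. -/
theorem exists_isUltra_not_eqOn {x y : S} (hxy : x ≠ y) : ∃ U, IsUltra U ∧ ¬ EqOn U x y := by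
  -- The domain elements on which `x` and `y` agree form a proper ideal; `T` is the dual filter.
  obtain ⟨U, hU, hTU⟩ := exists_isUltra
    (T := {α : S | ant (ant α) = α ∧ ant α * x = ant α * y})
    ⟨1, by rw [ant_one, ant_zero], by rw [ant_one, zero_mul, zero_mul]⟩ (fun γ h => h.1)
    (by
      rintro α ⟨hα, e⟩ β ⟨hβ, k⟩
      refine ⟨dom_mul hα hβ, ?_⟩
      have hc {γ : S} (hγ : ant (ant γ) = γ) := dom_comm (ant_ant_ant (α * β)) hγ
      -- `x` and `y` agree on `a(α)` and on `a(β)`, and `α ; a(α ; β)` lies below `a(β)`.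
      refine ext_ant α _ _ ?_ ?_
      · rw [← mul_assoc, ← mul_assoc, ← hc (ant_ant_ant α), mul_assoc, e, mul_assoc]
      · rw [hα]
        have h : α * ant (α * β) * ant (ant β) = 0 := by
          rw [hβ, mul_assoc, hc hβ, ← mul_assoc, ← dom_comm (ant_ant_ant (α * β)) (dom_mul hα hβ),
            ant_mul_self]
        have h' := mul_ant_of_mul_eq_zero h
        rw [ant_ant_ant] at h'
        rw [← mul_assoc, ← mul_assoc, ← h', mul_assoc _ _ x, mul_assoc _ _ y, k])
    (by
      rintro ⟨-, e⟩
      rw [ant_zero, one_mul, one_mul] at e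
      exact hxy e)
  refine ⟨U, hU, ?_⟩
  rintro ⟨γ, hγ, e⟩
  refine hU.ant_mem_iff.1 (hTU ⟨ant_ant_ant γ, ?_⟩) ((hU.dom γ hγ).symm ▸ hγ)
  rw [hU.dom γ hγ, e]

end Ultrafilters

/-! ### The representation -/

section Points

variable {S : Type u} [AntidomainRangeMonoid S]

/-- A point of the representation with ultrafilter `U`: an injective labelling of the elements of
`S` modulo `U` by labels in `ℕ × S`, where the class of `0` gets no label, that leaves as many
labels unused as there are labels. Think of `f x` as the name of the point reached by applying `x`
to the point. -/
structure IsLabelling (U : Set S) (f : S → Option (ℕ × S)) : Prop where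
  ultra : IsUltra U
  zero : f 0 = none
  eq_iff : ∀ x y, f x = f y ↔ EqOn U x y
  unused : ∃ j : ℕ × S → ℕ × S, Function.Injective j ∧ ∀ l x, f x ≠ some (j l)

/-- The points of the representation. -/
abbrev Point (S : Type u) [AntidomainRangeMonoid S] : Type u :=
  {f : S → Option (ℕ × S) // ∃ U, IsLabelling U f}

namespace IsLabelling

variable {U : Set S} {f : S → Option (ℕ × S)}

theorem eq_none_iff (h : IsLabelling U f) {x : S} : f x = none ↔ ¬ ant (ant x) ∈ U := by
  rw [← h.zero, h.eq_iff, h.ultra.eqOn_zero_iff]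

/-- Applying `s` to a point. -/
theorem shift (h : IsLabelling U f) {s : S} (hs : f s ≠ none) :
    ∃ V, IsLabelling V fun x => f (s * x) := by
  have hs' : ant (ant s) ∈ U := by
    by_contra h'
    exact hs (h.eq_none_iff.2 h')
  obtain ⟨V, hV, H⟩ := h.ultra.exists_image hs'
  obtain ⟨j, hj, hjf⟩ := h.unused
  exact ⟨V, hV, by rw [mul_zero, h.zero],
    fun x y => by rw [h.eq_iff, hV.eqOn_mul_left_iff h.ultra H], j, hj, fun l x => hjf l _⟩

/-- If `V` is an `s`-preimage of `U`, then every point over `U` is obtained by applying `s` to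
some point over `V`: the labelling is transported along the embedding `x ↦ s ; x` and extended to
the remaining elements by half of the unused labels. -/
theorem exists_preimage (h : IsLabelling U f) {V : Set S} (hV : IsUltra V) {s : S}
    (H : ∀ α ∈ U, ant (ant (s * α)) ∈ V) :
    ∃ g, IsLabelling V g ∧ (fun x => g (s * x)) = f := by
  classical
  obtain ⟨j, hj, hjf⟩ := h.unused
  let R : Setoid S := ⟨EqOn V, hV.eqOn_refl, EqOn.symm, hV.eqOn_trans⟩
  have hR : ∀ z w, (⟦z⟧ : Quotient R).out = (⟦w⟧ : Quotient R).out ↔ EqOn V z w := fun z w => by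
    rw [Quotient.out_inj, Quotient.eq]
    rfl
  let g : S → Option (ℕ × S) := fun z =>
    if k : ∃ y, EqOn V z (s * y) then f k.choose else some (j (0, (⟦z⟧ : Quotient R).out))
  have hg : ∀ z y, EqOn V z (s * y) → g z = f y := fun z y hz => by
    have k : ∃ y, EqOn V z (s * y) := ⟨y, hz⟩
    simp only [g, dif_pos k]
    rw [h.eq_iff, ← h.ultra.eqOn_mul_left_iff hV H]
    exact hV.eqOn_trans k.choose_spec.symm hz
  have hg' : ∀ z, (¬ ∃ y, EqOn V z (s * y)) → g z = some (j (0, (⟦z⟧ : Quotient R).out)) :=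
    fun z k => dif_neg k
  refine ⟨g, ⟨hV, ?_, fun z w => ?_, fun l => j (l.1 + 1, l.2), ?_, ?_⟩, ?_⟩
  · rw [hg 0 0 (by rw [mul_zero]; exact hV.eqOn_refl 0), h.zero]
  · by_cases hz : ∃ y, EqOn V z (s * y)
    · obtain ⟨y, hy⟩ := hz
      rw [hg z y hy]
      by_cases hw : ∃ y, EqOn V w (s * y)
      · obtain ⟨y', hy'⟩ := hw
        rw [hg w y' hy', h.eq_iff, ← h.ultra.eqOn_mul_left_iff hV H]
        exact ⟨fun e => hV.eqOn_trans hy (hV.eqOn_trans e hy'.symm),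
          fun e => hV.eqOn_trans hy.symm (hV.eqOn_trans e hy')⟩
      · rw [hg' w hw]
        exact iff_of_false (hjf _ _) fun e => hw ⟨y, hV.eqOn_trans e.symm hy⟩
    · rw [hg' z hz]
      by_cases hw : ∃ y, EqOn V w (s * y)
      · obtain ⟨y, hy⟩ := hw
        rw [hg w y hy]
        exact iff_of_false (hjf _ _).symm fun e => hz ⟨y, hV.eqOn_trans e hy⟩
      · rw [hg' w hw, Option.some_inj, hj.eq_iff, Prod.mk_right_inj, hR]
  · rintro ⟨m, x⟩ ⟨n, y⟩ e
    simpa using hj e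
  · rintro ⟨n, x⟩ z
    by_cases hz : ∃ y, EqOn V z (s * y)
    · obtain ⟨y, hy⟩ := hz
      rw [hg z y hy]
      exact hjf _ _
    · rw [hg' z hz]
      intro e
      simpa using hj (Option.some_inj.1 e)
  · funext x
    exact hg _ _ (hV.eqOn_refl _)

end IsLabelling

theorem IsUltra.exists_isLabelling {U : Set S} (hU : IsUltra U) : ∃ f, IsLabelling U f := by
  classical
  let R : Setoid S := ⟨EqOn U, hU.eqOn_refl, EqOn.symm, hU.eqOn_trans⟩
  have hR : ∀ z w, (⟦z⟧ : Quotient R).out = (⟦w⟧ : Quotient R).out ↔ EqOn U z w := fun z w => by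
    rw [Quotient.out_inj, Quotient.eq]
    rfl
  refine ⟨fun z => if EqOn U z 0 then none else some (0, (⟦z⟧ : Quotient R).out), hU,
    if_pos (hU.eqOn_refl 0), fun z w => ?_, fun l => (l.1 + 1, l.2), ?_, ?_⟩
  · by_cases hz : EqOn U z 0 <;> by_cases hw : EqOn U w 0
    · simpa [hz, hw] using hU.eqOn_trans hz hw.symm
    · simpa [hz, hw] using fun e : EqOn U z w => hw (hU.eqOn_trans e.symm hz)
    · simpa [hz, hw] using fun e : EqOn U z w => hz (hU.eqOn_trans e hw)
    · simp [hz, hw, hR]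
  · rintro ⟨m, x⟩ ⟨n, y⟩ e
    simpa using e
  · rintro ⟨n, x⟩ z
    by_cases hz : EqOn U z 0 <;> simp [hz]

/-- The action of `s` on points. -/
def Point.act (s : S) : Point S →. Point S := fun f =>
  ⟨f.1 s ≠ none, fun hs => ⟨fun x => f.1 (s * x), f.2.elim fun _ h => h.shift hs⟩⟩

theorem Point.mem_act {s : S} {f g : Point S} :
    g ∈ Point.act s f ↔ f.1 s ≠ none ∧ g.1 = fun x => f.1 (s * x) :=
  ⟨fun ⟨h, e⟩ => ⟨h, e ▸ rfl⟩, fun ⟨h, e⟩ => ⟨h, Subtype.ext e.symm⟩⟩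

theorem Point.exists_mem_act {s : S} {f : Point S} :
    (∃ g, g ∈ Point.act s f) ↔ f.1 s ≠ none :=
  Part.dom_iff_mem.symm

variable (S) in
/-- The representation theorem. The last clause, that elements which agree at a point agree on a
domain element fixing that point, makes the representation preserve intersections. -/
theorem AntidomainRangeMonoid.exists_representation :
    ∃ (X : Type u) (φ : S → X →. X), Function.Injective φ ∧
      (∀ x y, φ (x * y) = pcomp (φ x) (φ y)) ∧ (∀ x, φ (ant x) = panti (φ x)) ∧
      (∀ x, φ (ran x) = pran (φ x)) ∧
      ∀ x y p q, q ∈ φ x p → q ∈ φ y p →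
        ∃ α, ant (ant α) = α ∧ (∃ q, q ∈ φ α p) ∧ α * x = α * y := by
  refine ⟨Point S, Point.act, ?_, ?_, ?_, ?_, ?_⟩
  · intro x y hxy
    by_contra hne
    obtain ⟨U, hU, hxyU⟩ := exists_isUltra_not_eqOn hne
    obtain ⟨f, hf⟩ := hU.exists_isLabelling
    refine hxyU ((hf.eq_iff x y).1 ?_)
    let p : Point S := ⟨f, U, hf⟩
    have h : ∀ z w : S, Point.act z = Point.act w → f z ≠ none → f z = f w := fun z w e hz => by
      obtain ⟨g, hg⟩ := Point.exists_mem_act (f := p).2 hz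
      have h₁ := (Point.mem_act.1 hg).2
      rw [e] at hg
      have h₂ := (Point.mem_act.1 hg).2
      simpa [p] using congrFun (h₁.symm.trans h₂) 1
    by_cases hx : f x = none
    · by_cases hy : f y = none
      · rw [hx, hy]
      · exact (h y x hxy.symm hy).symm
    · exact h x y hxy hx
  · intro x y
    refine pfun_ext fun f g => ?_
    obtain ⟨U, hf⟩ := f.2
    rw [Point.mem_act, mem_pcomp]
    constructor
    · rintro ⟨h, e⟩
      have hx : f.1 x ≠ none := fun hx => h (by
        rw [← hf.zero, hf.eq_iff] at hx ⊢
        obtain ⟨α, hα, k⟩ := hx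
        exact ⟨α, hα, by rw [← mul_assoc, k, mul_zero, zero_mul]⟩)
      obtain ⟨z, hz⟩ := Point.exists_mem_act.2 hx
      refine ⟨z, hz, Point.mem_act.2 ?_⟩
      rw [(Point.mem_act.1 hz).2, e]
      exact ⟨h, funext fun w => by rw [mul_assoc]⟩
    · rintro ⟨z, hz, hg⟩
      rw [Point.mem_act, (Point.mem_act.1 hz).2] at hg
      exact ⟨hg.1, hg.2.trans (funext fun w => by rw [mul_assoc])⟩
  · intro x
    refine pfun_ext fun f g => ?_
    obtain ⟨U, hf⟩ := f.2
    rw [mem_panti, Point.mem_act, Point.exists_mem_act, Ne, Ne, hf.eq_none_iff, hf.eq_none_iff,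
      ant_ant_ant, not_not, not_not, hf.ultra.ant_mem_iff, and_comm]
    refine and_congr_left fun h => ?_
    have : (fun z => f.1 (ant x * z)) = f.1 := funext fun z =>
      (hf.eq_iff _ _).2 ⟨ant x, hf.ultra.ant_mem_iff.2 h, by rw [← mul_assoc, ant_idem]⟩
    rw [this]
    exact Subtype.ext_iff.symm
  · intro x
    refine pfun_ext fun f g => ?_
    obtain ⟨U, hf⟩ := f.2
    rw [mem_pran, Point.mem_act]
    constructor
    · rintro ⟨h, e⟩
      have hr : ran x ∈ U := by
        rw [← ant_ant_ran]
        by_contra h'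
        exact h (hf.eq_none_iff.2 h')
      have hfix : (fun z => f.1 (ran x * z)) = f.1 := funext fun z =>
        (hf.eq_iff _ _).2 ⟨ran x, hr, by rw [← mul_assoc, dom_idem (ant_ant_ran x)]⟩
      obtain ⟨V, hV, H⟩ := hf.ultra.exists_preimage hr
      obtain ⟨g', hg', e'⟩ := hf.exists_preimage hV H
      refine ⟨Subtype.ext (e.trans hfix), ⟨g', V, hg'⟩, Point.mem_act.2 ⟨?_, e'.symm⟩⟩
      have := H 1 hf.ultra.one_mem
      rw [mul_one] at this
      exact fun hn => hg'.eq_none_iff.1 hn this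
    · rintro ⟨rfl, p, hp⟩
      obtain ⟨hpx, e⟩ := Point.mem_act.1 hp
      rw [e]
      exact ⟨by simpa only [mul_ran] using hpx, funext fun z => by simp only [← mul_assoc, mul_ran]⟩
  · intro x y p q hx hy
    obtain ⟨U, hp⟩ := p.2
    have h := congrFun ((Point.mem_act.1 hx).2.symm.trans (Point.mem_act.1 hy).2) 1
    simp only [mul_one] at h
    obtain ⟨α, hα, e⟩ := (hp.eq_iff _ _).1 h
    refine ⟨α, hp.ultra.dom α hα, Point.exists_mem_act.2 fun hn => hp.eq_none_iff.1 hn ?_, e⟩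
    rwa [hp.ultra.dom α hα]

end Points

/-! ### Representations as homomorphisms -/

section Homomorphisms

variable {S : Type u} {c m p : S → S → S} {a r i : S → S}

/-- `φ` represents composition, antidomain and range faithfully, and elements which agree at a
point agree on a domain element that is defined at this point. -/
structure IsLocallyFreeRep {X : Type v} (c : S → S → S) (a r : S → S) (φ : S → X →. X) :
    Prop where
  injective : Function.Injective φ
  comp : ∀ x y, φ (c x y) = pcomp (φ x) (φ y)
  anti : ∀ x, φ (a x) = panti (φ x)
  ran : ∀ x, φ (r x) = pran (φ x)
  agree : ∀ x y p q, q ∈ φ x p → q ∈ φ y p →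
    ∃ α, IsDomElt a α ∧ (∃ q, q ∈ φ α p) ∧ c α x = c α y

theorem AxiomsAR.exists_isLocallyFreeRep (h : AxiomsAR c a r) :
    ∃ (X : Type u) (φ : S → X →. X), IsLocallyFreeRep c a r φ := by
  rcases isEmpty_or_nonempty S with hS | ⟨⟨w⟩⟩
  · exact ⟨PEmpty, isEmptyElim, fun x => isEmptyElim x, fun x => isEmptyElim x,
      fun x => isEmptyElim x, fun x => isEmptyElim x, fun x => isEmptyElim x⟩
  · let _ := h.toAntidomainRangeMonoid w
    obtain ⟨X, φ, h₁, h₂, h₃, h₄, h₅⟩ := exists_representation S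
    exact ⟨X, φ, h₁, h₂, h₃, h₄, h₅⟩

namespace IsLocallyFreeRep

variable {X : Type v} {φ : S → X →. X}

theorem dom (hφ : IsLocallyFreeRep c a r φ) (x : S) : φ (derivedDom a x) = pdom (φ x) := by
  rw [derivedDom, hφ.anti, hφ.anti, panti_panti]

theorem meet (hφ : IsLocallyFreeRep c a r φ) (hs : SemilatticeLaws m)
    (hm : MeetLaws c m (derivedDom a)) (x y : S) :
    φ (m x y) = pmeet (φ x) (φ y) := by
  have le : ∀ x y p q, q ∈ φ (m x y) p → q ∈ φ x p := fun x y p q h => by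
    rw [hm.order, hφ.comp, hφ.dom, mem_pcomp] at h
    obtain ⟨z, hz, h⟩ := h
    rwa [(mem_pdom.1 hz).1] at h
  refine pfun_ext fun p q => ?_
  rw [mem_pmeet]
  refine ⟨fun h => ⟨le x y p q h, le y x p q (by rwa [hs.comm])⟩, fun ⟨hx, hy⟩ => ?_⟩
  obtain ⟨α, hα, ⟨p', hp⟩, e⟩ := hφ.agree x y p q hx hy
  have hp' : p' = p := by
    rw [← hα, hφ.dom] at hp
    exact (mem_pdom.1 hp).1
  subst hp'
  have h : q ∈ φ (c α (m x y)) p' := by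
    rw [hm.twisted, ← e, hs.idem, hφ.comp, mem_pcomp]
    exact ⟨p', hp, hx⟩
  rw [hφ.comp, mem_pcomp] at h
  obtain ⟨z, hz, h⟩ := h
  rwa [Part.mem_unique hp hz]

theorem pref (hφ : IsLocallyFreeRep c a r φ) (hp : PrefLaws c a p) (x y : S) :
    φ (p x y) = ppref (φ x) (φ y) := by
  refine eq_ppref ?_ ?_
  · rw [← hφ.dom, ← hφ.comp, hp.dom_pref]
  · rw [← hφ.anti, ← hφ.comp, hp.anti_pref, hφ.comp]

/-- In a finite algebra the domains of the powers of `x` become stationary. The stationary domain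
is preserved by `x`, hence by its maximum iterate, which therefore is undefined there. -/
theorem iter [Finite S] (hφ : IsLocallyFreeRep c a r φ) (hi : IterLaws c a i) (x : S) :
    φ (i x) = piter (φ x) := by
  set f := φ x with hf
  -- `pw n` is the power of `x` with exponent `n + 1`.
  let pw : ℕ → S := fun n => (c x)^[n] x
  have hpw : ∀ n, φ (pw n) = ppow f (n + 1) := fun n => by
    induction n with
    | zero =>
      refine pfun_ext fun p q => ?_
      rw [mem_ppow_succ]
      simp only [mem_ppow_zero]
      exact ⟨fun h => ⟨q, h, rfl⟩, fun ⟨z, hz, e⟩ => e ▸ hz⟩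
    | succ n ih =>
      have : pw (n + 1) = c x (pw n) := Function.iterate_succ_apply' _ _ _
      rw [this, hφ.comp, ih]
      rfl
  have anti : ∀ n p, (∃ z, z ∈ ppow f (n + 1) p) → ∃ z, z ∈ ppow f n p := by
    intro n
    induction n with
    | zero => exact fun p _ => ⟨p, mem_ppow_zero.2 rfl⟩
    | succ n ih =>
      rintro p ⟨z, hz⟩
      obtain ⟨q, hq, hz⟩ := mem_ppow_succ.1 hz
      exact (ih q ⟨z, hz⟩).imp fun w hw => mem_ppow_succ.2 ⟨q, hq, hw⟩
  obtain ⟨m, hm⟩ : ∃ m, ∀ p, (∃ z, z ∈ ppow f (m + 1) p) → ∃ z, z ∈ ppow f (m + 2) p := by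
    obtain ⟨m, n, hmn, e⟩ :
        ∃ m n, m < n ∧ derivedDom a (pw m) = derivedDom a (pw n) := by
      obtain ⟨m, n, hne, e⟩ :=
        Finite.exists_ne_map_eq_of_infinite fun n => derivedDom a (pw n)
      rcases lt_or_gt_of_ne hne with h | h
      · exact ⟨m, n, h, e⟩
      · exact ⟨n, m, h, e.symm⟩
    refine ⟨m, fun p hp => ?_⟩
    have hn : ∃ z, z ∈ ppow f (n + 1) p := by
      have e' := congrArg φ e
      rw [hφ.dom, hφ.dom, hpw, hpw] at e'
      exact (mem_pdom.1 (e' ▸ mem_pdom.2 ⟨rfl, hp⟩ : p ∈ pdom (ppow f (n + 1)) p)).2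
    have down : ∀ k, m + 2 ≤ k → (∃ z, z ∈ ppow f k p) → ∃ z, z ∈ ppow f (m + 2) p := by
      intro k hk
      induction k, hk using Nat.le_induction with
      | base => exact id
      | succ k _ ih => exact fun h => ih (anti k p h)
    exact down (n + 1) (by lia) hn
  have inv : c (derivedDom a (pw m)) x = c (c (derivedDom a (pw m)) x) (derivedDom a (pw m)) := by
    apply hφ.injective
    rw [hφ.comp, hφ.comp, hφ.comp, hφ.dom, hpw, ← hf]
    refine pfun_ext fun p q => ?_
    simp only [mem_pcomp, mem_pdom]
    constructor
    · rintro ⟨_, ⟨rfl, hp⟩, hq⟩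
      refine ⟨q, ⟨_, ⟨rfl, hp⟩, hq⟩, rfl, ?_⟩
      obtain ⟨w, hw⟩ := hm _ hp
      obtain ⟨q', hq', hw⟩ := mem_ppow_succ.1 hw
      exact Part.mem_unique hq hq' ▸ ⟨w, hw⟩
    · rintro ⟨_, h, rfl, -⟩
      exact h
  refine eq_piter ?_ ?_ ?_
  · rw [← hφ.dom, ← hφ.comp, hi.dom_iter, hφ.comp]
  · rw [← hφ.anti, ← hφ.comp, hi.anti_iter]
  · intro p q hp hq
    have h₁ : q ∈ pcomp (pcomp (pdom (φ (pw m))) (φ (i x))) (pdom (φ (pw m))) p := by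
      rw [← hφ.dom, ← hφ.comp, ← hφ.comp, ← hi.invariant _ _ inv, hφ.comp, hφ.dom, hpw]
      exact mem_pcomp.2 ⟨p, mem_pdom.2 ⟨rfl, hp _⟩, hq⟩
    obtain ⟨q', -, h₁⟩ := mem_pcomp.1 h₁
    obtain ⟨rfl, z, hz⟩ := mem_pdom.1 h₁
    rw [hpw, mem_ppow_succ] at hz
    obtain ⟨w, hw, -⟩ := hz
    rw [← hi.iter_anti, hφ.comp, hφ.anti, mem_pcomp] at hq
    obtain ⟨q', -, hq⟩ := hq
    obtain ⟨rfl, hq⟩ := mem_panti.1 hq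
    exact hq ⟨w, hw⟩

end IsLocallyFreeRep

end Homomorphisms

/-! ### Algebras over a similarity type -/

section Signatures

open scoped FirstOrder

/-- A representable algebra is one that embeds into an algebra of all partial functions. -/
theorem representable_iff {τ : Sig} {S : Type u} [(lang τ).Structure S] :
    Representable τ S ↔ ∃ (X : Type u) (φ : S → X →. X), Function.Injective φ ∧
      ∀ (n : ℕ) (o : (lang τ).Functions n) (xs : Fin n → S),
        φ (FirstOrder.Language.Structure.funMap o xs) =
          FirstOrder.Language.Structure.funMap o (φ ∘ xs) := by
  constructor
  · rintro ⟨X, T, ⟨e⟩⟩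
    exact ⟨X, fun x => (e x : X →. X), Subtype.val_injective.comp e.injective,
      fun n o xs => (T.subtype.comp e.toEmbedding).map_fun o xs⟩
  · rintro ⟨X, φ, hφ, h⟩
    let E : S ↪[lang τ] (X →. X) :=
      { toFun := φ, inj' := hφ, map_fun' := fun o xs => h _ o xs, map_rel' := fun R => R.elim }
    exact ⟨X, E.toHom.range, ⟨E.equivRange⟩⟩

variable {τ : Sig} {S : Type u} [(lang τ).Structure S]

theorem funMap_eq_bin (o : Op 2) [h : Has τ o] (k) (xs : Fin 2 → S) :
    FirstOrder.Language.Structure.funMap (L := lang τ) ⟨o, k⟩ xs = bin τ o (xs 0) (xs 1) := by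
  rw [bin]
  congr 1
  ext i
  fin_cases i <;> rfl

theorem funMap_eq_un (o : Op 1) [h : Has τ o] (k) (xs : Fin 1 → S) :
    FirstOrder.Language.Structure.funMap (L := lang τ) ⟨o, k⟩ xs = un τ o (xs 0) := by
  rw [un]
  congr 1
  ext i
  fin_cases i
  rfl

variable {T : Type v} [(lang τ).Structure T] {φ : S → T}

theorem map_bin (h : ∀ (n : ℕ) (o : (lang τ).Functions n) (xs : Fin n → S),
      φ (FirstOrder.Language.Structure.funMap o xs) =
        FirstOrder.Language.Structure.funMap o (φ ∘ xs)) (o : Op 2) [Has τ o] (x y : S) :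
    φ (bin τ o x y) = bin τ o (φ x) (φ y) := by
  exact (h 2 ⟨o, Has.mem⟩ ![x, y]).trans (funMap_eq_bin o Has.mem _)

theorem map_un (h : ∀ (n : ℕ) (o : (lang τ).Functions n) (xs : Fin n → S),
      φ (FirstOrder.Language.Structure.funMap o xs) =
        FirstOrder.Language.Structure.funMap o (φ ∘ xs)) (o : Op 1) [Has τ o] (x : S) :
    φ (un τ o x) = un τ o (φ x) := by
  exact (h 1 ⟨o, Has.mem⟩ ![x]).trans (funMap_eq_un o Has.mem _)

end Signatures

section Representable

variable {S : Type u}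

theorem representable_sigAR_iff [(lang sigAR).Structure S] :
    Representable sigAR S ↔
      AxiomsAR (bin sigAR Op.comp (S := S))
        (un sigAR Op.anti) (un sigAR Op.ran) := by
  rw [representable_iff]
  constructor
  · rintro ⟨X, φ, hφ, h⟩
    exact (axiomsMAR_partialFunctions X).toAxiomsAR.pullback hφ (map_bin h Op.comp)
        (map_un h Op.anti) (map_un h Op.ran)
  · intro h
    obtain ⟨X, φ, hφ⟩ := h.exists_isLocallyFreeRep
    refine ⟨X, φ, hφ.injective, ?_⟩
    rintro n ⟨o, ho⟩ xs
    cases o with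
    | comp => exact (congrArg φ (funMap_eq_bin Op.comp ho xs)).trans (hφ.comp _ _)
    | anti => exact (congrArg φ (funMap_eq_un Op.anti ho xs)).trans (hφ.anti _)
    | ran => exact (congrArg φ (funMap_eq_un Op.ran ho xs)).trans (hφ.ran _)
    | _ => simp at ho

theorem representable_sigMAR_iff [(lang sigMAR).Structure S] :
    Representable sigMAR S ↔
      AxiomsMAR (bin sigMAR Op.comp (S := S)) (bin sigMAR Op.meet)
        (un sigMAR Op.anti) (un sigMAR Op.ran) := by
  rw [representable_iff]
  constructor
  · rintro ⟨X, φ, hφ, h⟩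
    exact (axiomsMAR_partialFunctions X).pullback hφ (map_bin h Op.comp) (map_bin h Op.meet)
        (map_un h Op.anti) (map_un h Op.ran)
  · intro h
    obtain ⟨X, φ, hφ⟩ := h.toAxiomsAR.exists_isLocallyFreeRep
    refine ⟨X, φ, hφ.injective, ?_⟩
    rintro n ⟨o, ho⟩ xs
    cases o with
    | comp => exact (congrArg φ (funMap_eq_bin Op.comp ho xs)).trans (hφ.comp _ _)
    | meet =>
      exact (congrArg φ (funMap_eq_bin Op.meet ho xs)).trans
        (hφ.meet h.semilattice h.meet _ _)
    | anti => exact (congrArg φ (funMap_eq_un Op.anti ho xs)).trans (hφ.anti _)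
    | ran => exact (congrArg φ (funMap_eq_un Op.ran ho xs)).trans (hφ.ran _)
    | _ => simp at ho

theorem representable_withIter_sigAR_iff [(lang (withIter sigAR)).Structure S] [Finite S] :
    Representable (withIter sigAR) S ↔
      AxiomsAR (bin (withIter sigAR) Op.comp (S := S))
        (un (withIter sigAR) Op.anti) (un (withIter sigAR) Op.ran) ∧
      IterLaws (bin (withIter sigAR) Op.comp (S := S)) (un (withIter sigAR) Op.anti)
        (un (withIter sigAR) Op.iter) := by
  rw [representable_iff]
  constructor
  · rintro ⟨X, φ, hφ, h⟩
    exact ⟨(axiomsMAR_partialFunctions X).toAxiomsAR.pullback hφ (map_bin h Op.comp)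
        (map_un h Op.anti) (map_un h Op.ran),
      iterLaws_piter.pullback hφ (map_bin h Op.comp) (map_un h Op.anti)
        (map_un h Op.iter)⟩
  · rintro ⟨h, hi⟩
    obtain ⟨X, φ, hφ⟩ := h.exists_isLocallyFreeRep
    refine ⟨X, φ, hφ.injective, ?_⟩
    rintro n ⟨o, ho⟩ xs
    cases o with
    | comp => exact (congrArg φ (funMap_eq_bin Op.comp ho xs)).trans (hφ.comp _ _)
    | anti => exact (congrArg φ (funMap_eq_un Op.anti ho xs)).trans (hφ.anti _)
    | ran => exact (congrArg φ (funMap_eq_un Op.ran ho xs)).trans (hφ.ran _)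
    | iter => exact (congrArg φ (funMap_eq_un Op.iter ho xs)).trans (hφ.iter hi _)
    | _ => simp at ho

theorem representable_withIter_sigMAR_iff [(lang (withIter sigMAR)).Structure S] [Finite S] :
    Representable (withIter sigMAR) S ↔
      AxiomsMAR (bin (withIter sigMAR) Op.comp (S := S)) (bin (withIter sigMAR) Op.meet)
        (un (withIter sigMAR) Op.anti) (un (withIter sigMAR) Op.ran) ∧
      IterLaws (bin (withIter sigMAR) Op.comp (S := S)) (un (withIter sigMAR) Op.anti)
        (un (withIter sigMAR) Op.iter) := by
  rw [representable_iff]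
  constructor
  · rintro ⟨X, φ, hφ, h⟩
    exact ⟨(axiomsMAR_partialFunctions X).pullback hφ (map_bin h Op.comp) (map_bin h Op.meet)
        (map_un h Op.anti) (map_un h Op.ran),
      iterLaws_piter.pullback hφ (map_bin h Op.comp) (map_un h Op.anti)
        (map_un h Op.iter)⟩
  · rintro ⟨h, hi⟩
    obtain ⟨X, φ, hφ⟩ := h.toAxiomsAR.exists_isLocallyFreeRep
    refine ⟨X, φ, hφ.injective, ?_⟩
    rintro n ⟨o, ho⟩ xs
    cases o with
    | comp => exact (congrArg φ (funMap_eq_bin Op.comp ho xs)).trans (hφ.comp _ _)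
    | meet =>
      exact (congrArg φ (funMap_eq_bin Op.meet ho xs)).trans
        (hφ.meet h.semilattice h.meet _ _)
    | anti => exact (congrArg φ (funMap_eq_un Op.anti ho xs)).trans (hφ.anti _)
    | ran => exact (congrArg φ (funMap_eq_un Op.ran ho xs)).trans (hφ.ran _)
    | iter => exact (congrArg φ (funMap_eq_un Op.iter ho xs)).trans (hφ.iter hi _)
    | _ => simp at ho

theorem representable_withPref_sigAR_iff [(lang (withPref sigAR)).Structure S] :
    Representable (withPref sigAR) S ↔
      AxiomsAR (bin (withPref sigAR) Op.comp (S := S))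
        (un (withPref sigAR) Op.anti) (un (withPref sigAR) Op.ran) ∧
      PrefLaws (bin (withPref sigAR) Op.comp (S := S)) (un (withPref sigAR) Op.anti)
        (bin (withPref sigAR) Op.pref) := by
  rw [representable_iff]
  constructor
  · rintro ⟨X, φ, hφ, h⟩
    exact ⟨(axiomsMAR_partialFunctions X).toAxiomsAR.pullback hφ (map_bin h Op.comp)
        (map_un h Op.anti) (map_un h Op.ran),
      prefLaws_ppref.pullback hφ (map_bin h Op.comp) (map_un h Op.anti)
        (map_bin h Op.pref)⟩
  · rintro ⟨h, hp⟩
    obtain ⟨X, φ, hφ⟩ := h.exists_isLocallyFreeRep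
    refine ⟨X, φ, hφ.injective, ?_⟩
    rintro n ⟨o, ho⟩ xs
    cases o with
    | comp => exact (congrArg φ (funMap_eq_bin Op.comp ho xs)).trans (hφ.comp _ _)
    | anti => exact (congrArg φ (funMap_eq_un Op.anti ho xs)).trans (hφ.anti _)
    | ran => exact (congrArg φ (funMap_eq_un Op.ran ho xs)).trans (hφ.ran _)
    | pref => exact (congrArg φ (funMap_eq_bin Op.pref ho xs)).trans (hφ.pref hp _ _)
    | _ => simp at ho

theorem representable_withPref_sigMAR_iff [(lang (withPref sigMAR)).Structure S] :
    Representable (withPref sigMAR) S ↔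
      AxiomsMAR (bin (withPref sigMAR) Op.comp (S := S)) (bin (withPref sigMAR) Op.meet)
        (un (withPref sigMAR) Op.anti) (un (withPref sigMAR) Op.ran) ∧
      PrefLaws (bin (withPref sigMAR) Op.comp (S := S)) (un (withPref sigMAR) Op.anti)
        (bin (withPref sigMAR) Op.pref) := by
  rw [representable_iff]
  constructor
  · rintro ⟨X, φ, hφ, h⟩
    exact ⟨(axiomsMAR_partialFunctions X).pullback hφ (map_bin h Op.comp) (map_bin h Op.meet)
        (map_un h Op.anti) (map_un h Op.ran),
      prefLaws_ppref.pullback hφ (map_bin h Op.comp) (map_un h Op.anti)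
        (map_bin h Op.pref)⟩
  · rintro ⟨h, hp⟩
    obtain ⟨X, φ, hφ⟩ := h.toAxiomsAR.exists_isLocallyFreeRep
    refine ⟨X, φ, hφ.injective, ?_⟩
    rintro n ⟨o, ho⟩ xs
    cases o with
    | comp => exact (congrArg φ (funMap_eq_bin Op.comp ho xs)).trans (hφ.comp _ _)
    | meet =>
      exact (congrArg φ (funMap_eq_bin Op.meet ho xs)).trans
        (hφ.meet h.semilattice h.meet _ _)
    | anti => exact (congrArg φ (funMap_eq_un Op.anti ho xs)).trans (hφ.anti _)
    | ran => exact (congrArg φ (funMap_eq_un Op.ran ho xs)).trans (hφ.ran _)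
    | pref => exact (congrArg φ (funMap_eq_bin Op.pref ho xs)).trans (hφ.pref hp _ _)
    | _ => simp at ho

theorem representable_withIter_withPref_sigAR_iff
    [(lang (withIter (withPref sigAR))).Structure S] [Finite S] :
    Representable (withIter (withPref sigAR)) S ↔
      AxiomsAR (bin (withIter (withPref sigAR)) Op.comp (S := S))
        (un (withIter (withPref sigAR)) Op.anti) (un (withIter (withPref sigAR)) Op.ran) ∧
      PrefLaws (bin (withIter (withPref sigAR)) Op.comp (S := S)) (un (withIter (withPref sigAR)) Op.anti)
        (bin (withIter (withPref sigAR)) Op.pref) ∧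
      IterLaws (bin (withIter (withPref sigAR)) Op.comp (S := S)) (un (withIter (withPref sigAR)) Op.anti)
        (un (withIter (withPref sigAR)) Op.iter) := by
  rw [representable_iff]
  constructor
  · rintro ⟨X, φ, hφ, h⟩
    exact ⟨(axiomsMAR_partialFunctions X).toAxiomsAR.pullback hφ (map_bin h Op.comp)
        (map_un h Op.anti) (map_un h Op.ran),
      prefLaws_ppref.pullback hφ (map_bin h Op.comp) (map_un h Op.anti)
        (map_bin h Op.pref),
      iterLaws_piter.pullback hφ (map_bin h Op.comp) (map_un h Op.anti)
        (map_un h Op.iter)⟩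
  · rintro ⟨h, hp, hi⟩
    obtain ⟨X, φ, hφ⟩ := h.exists_isLocallyFreeRep
    refine ⟨X, φ, hφ.injective, ?_⟩
    rintro n ⟨o, ho⟩ xs
    cases o with
    | comp => exact (congrArg φ (funMap_eq_bin Op.comp ho xs)).trans (hφ.comp _ _)
    | anti => exact (congrArg φ (funMap_eq_un Op.anti ho xs)).trans (hφ.anti _)
    | ran => exact (congrArg φ (funMap_eq_un Op.ran ho xs)).trans (hφ.ran _)
    | pref => exact (congrArg φ (funMap_eq_bin Op.pref ho xs)).trans (hφ.pref hp _ _)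
    | iter => exact (congrArg φ (funMap_eq_un Op.iter ho xs)).trans (hφ.iter hi _)
    | _ => simp at ho

theorem representable_withIter_withPref_sigMAR_iff
    [(lang (withIter (withPref sigMAR))).Structure S] [Finite S] :
    Representable (withIter (withPref sigMAR)) S ↔
      AxiomsMAR (bin (withIter (withPref sigMAR)) Op.comp (S := S)) (bin (withIter (withPref sigMAR)) Op.meet)
        (un (withIter (withPref sigMAR)) Op.anti) (un (withIter (withPref sigMAR)) Op.ran) ∧
      PrefLaws (bin (withIter (withPref sigMAR)) Op.comp (S := S)) (un (withIter (withPref sigMAR)) Op.anti)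
        (bin (withIter (withPref sigMAR)) Op.pref) ∧
      IterLaws (bin (withIter (withPref sigMAR)) Op.comp (S := S)) (un (withIter (withPref sigMAR)) Op.anti)
        (un (withIter (withPref sigMAR)) Op.iter) := by
  rw [representable_iff]
  constructor
  · rintro ⟨X, φ, hφ, h⟩
    exact ⟨(axiomsMAR_partialFunctions X).pullback hφ (map_bin h Op.comp) (map_bin h Op.meet)
        (map_un h Op.anti) (map_un h Op.ran),
      prefLaws_ppref.pullback hφ (map_bin h Op.comp) (map_un h Op.anti)
        (map_bin h Op.pref),
      iterLaws_piter.pullback hφ (map_bin h Op.comp) (map_un h Op.anti)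
        (map_un h Op.iter)⟩
  · rintro ⟨h, hp, hi⟩
    obtain ⟨X, φ, hφ⟩ := h.toAxiomsAR.exists_isLocallyFreeRep
    refine ⟨X, φ, hφ.injective, ?_⟩
    rintro n ⟨o, ho⟩ xs
    cases o with
    | comp => exact (congrArg φ (funMap_eq_bin Op.comp ho xs)).trans (hφ.comp _ _)
    | meet =>
      exact (congrArg φ (funMap_eq_bin Op.meet ho xs)).trans
        (hφ.meet h.semilattice h.meet _ _)
    | anti => exact (congrArg φ (funMap_eq_un Op.anti ho xs)).trans (hφ.anti _)
    | ran => exact (congrArg φ (funMap_eq_un Op.ran ho xs)).trans (hφ.ran _)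
    | pref => exact (congrArg φ (funMap_eq_bin Op.pref ho xs)).trans (hφ.pref hp _ _)
    | iter => exact (congrArg φ (funMap_eq_un Op.iter ho xs)).trans (hφ.iter hi _)
    | _ => simp at ho

/-- Both reducts of a representable algebra are representable, and conversely the two reducts
together provide all laws. -/
theorem representable_sigMAR_iff_reducts [(lang sigMAR).Structure S] :
    Representable sigMAR S ↔
      @Representable sigMA S
          (algMA (bin sigMAR Op.comp) (bin sigMAR Op.meet) (un sigMAR Op.anti)) ∧
        @Representable sigMDR S
          (algMDR (bin sigMAR Op.comp) (bin sigMAR Op.meet)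
            (derivedDom (un sigMAR Op.anti)) (un sigMAR Op.ran)) ∧
        AntirangeLaw (bin sigMAR Op.comp (S := S)) (un sigMAR Op.anti) (un sigMAR Op.ran) := by
  constructor
  · intro hS
    have hax := representable_sigMAR_iff.1 hS
    obtain ⟨X, φ, hφ, h⟩ := representable_iff.1 hS
    refine ⟨?_, ?_, hax.antirange⟩
    · let _ : (lang sigMA).Structure S :=
        algMA (bin sigMAR Op.comp) (bin sigMAR Op.meet) (un sigMAR Op.anti)
      refine representable_iff.2 ⟨X, φ, hφ, ?_⟩
      rintro n ⟨o, ho⟩ xs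
      cases o with
      | comp => exact map_bin h Op.comp _ _
      | meet => exact map_bin h Op.meet _ _
      | anti => exact map_un h Op.anti _
      | _ => simp at ho
    · let _ : (lang sigMDR).Structure S :=
        algMDR (bin sigMAR Op.comp) (bin sigMAR Op.meet)
            (derivedDom (un sigMAR Op.anti)) (un sigMAR Op.ran)
      refine representable_iff.2 ⟨X, φ, hφ, ?_⟩
      rintro n ⟨o, ho⟩ xs
      cases o with
      | comp => exact map_bin h Op.comp _ _
      | meet => exact map_bin h Op.meet _ _
      | dom => exact (map_derivedDom (map_un h Op.anti) _).trans (panti_panti _)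
      | ran => exact map_un h Op.ran _
      | _ => simp at ho
  · rintro ⟨h₁, h₂, har⟩
    have hMA : AntidomainLaws (bin sigMAR Op.comp (S := S)) (un sigMAR Op.anti) ∧
        (∀ x y z, bin sigMAR Op.comp (bin sigMAR Op.comp x y) z =
          bin sigMAR Op.comp x (bin sigMAR Op.comp y (z : S))) ∧
        DomainLaws (bin sigMAR Op.comp (S := S)) (derivedDom (un sigMAR Op.anti)) ∧
        SemilatticeLaws (bin sigMAR Op.meet (S := S)) ∧
        MeetLaws (bin sigMAR Op.comp (S := S)) (bin sigMAR Op.meet)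
          (derivedDom (un sigMAR Op.anti)) := by
      let _ : (lang sigMA).Structure S :=
        algMA (bin sigMAR Op.comp) (bin sigMAR Op.meet) (un sigMAR Op.anti)
      obtain ⟨X, φ, hφ, h⟩ := representable_iff.1 h₁
      have hX := axiomsMAR_partialFunctions X
      have hc := map_bin h Op.comp
      have hm := map_bin h Op.meet
      have ha := map_un h Op.anti
      exact ⟨hX.antidomain.pullback hφ hc ha, assoc_pullback hφ hc hX.assoc,
        hX.domain.pullback hφ hc (map_derivedDom ha), hX.semilattice.pullback hφ hm,
        hX.meet.pullback hφ hc hm (map_derivedDom ha)⟩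
    have hMDR : RangeLaws (bin sigMAR Op.comp (S := S)) (un sigMAR Op.ran) ∧
        DomainRangeLaws (derivedDom (un sigMAR Op.anti)) (un sigMAR Op.ran (S := S)) := by
      let _ : (lang sigMDR).Structure S :=
        algMDR (bin sigMAR Op.comp) (bin sigMAR Op.meet)
            (derivedDom (un sigMAR Op.anti)) (un sigMAR Op.ran)
      obtain ⟨X, φ, hφ, h⟩ := representable_iff.1 h₂
      exact ⟨rangeLaws_pran.pullback hφ (map_bin h Op.comp) (map_un h Op.ran),
        domainRangeLaws_pdom_pran.pullback hφ (map_un h Op.dom) (map_un h Op.ran)⟩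
    exact representable_sigMAR_iff.2 ⟨hMA.2.1, hMA.2.2.1, hMA.2.2.2.1, hMA.2.2.2.2, hMA.1,
      hMDR.1, hMDR.2, har⟩

end Representable

/-! ### Identities and quasi-identities -/

section Terms

variable (τ : Sig)

/-- The application of a binary operation symbol to terms. -/
def termBin (o : Op 2) [h : Has τ o] (s t : (lang τ).Term ℕ) : (lang τ).Term ℕ :=
  .func (l := 2) ⟨o, h.mem⟩ ![s, t]

/-- The application of a unary operation symbol to a term. -/
def termUn (o : Op 1) [h : Has τ o] (s : (lang τ).Term ℕ) : (lang τ).Term ℕ :=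
  .func (l := 1) ⟨o, h.mem⟩ ![s]

variable {τ} {S : Type u} [(lang τ).Structure S]

theorem realize_termBin (o : Op 2) [Has τ o] (s t : (lang τ).Term ℕ) (w : ℕ → S) :
    (termBin τ o s t).realize w = bin τ o (s.realize w) (t.realize w) :=
  funMap_eq_bin o Has.mem _

theorem realize_termUn (o : Op 1) [Has τ o] (s : (lang τ).Term ℕ) (w : ℕ → S) :
    (termUn τ o s).realize w = un τ o (s.realize w) :=
  funMap_eq_un o Has.mem _

/-- The assignment of `x`, `y`, `z` to the variables. -/
def assignment {S : Type u} (x y z : S) : ℕ → S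
  | 0 => x
  | 1 => y
  | _ => z

end Terms

/-- The identities among the laws for `{;, a, r}`, with the domain elements of the antirange law
written as `a(a(x))` and `a(a(y))`. -/
structure EquationalLaws {S : Type u} (c : S → S → S) (a r : S → S) : Prop where
  assoc : ∀ x y z, c (c x y) z = c x (c y z)
  zero : ∀ x y, c (a x) x = c (a y) y
  zero_comp : ∀ x y, c (c (a x) x) y = c (a x) x
  one_comp : ∀ x y, c (a (c (a x) x)) y = y
  anti_comm : ∀ x y, c (a x) (a y) = c (a y) (a x)
  anti_twisted : ∀ x y, c x (a y) = c (a (c x y)) x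
  right_id : ∀ x, c x (r x) = x
  ran_comm : ∀ x y, c (r x) (r y) = c (r y) (r x)
  ran_ran : ∀ x, r (r x) = r x
  ran_order : ∀ x y, c (r (c x y)) (r y) = r (c x y)
  right_cong : ∀ x y, r (c (r x) y) = r (c x y)
  dom_ran : ∀ x, a (a (r x)) = r x
  ran_dom : ∀ x, r (a (a x)) = a (a x)
  antirange : ∀ x y z, a (c (a (r (c (a (a x)) z))) (a (r (c (a (a y)) z)))) =
    r (c (a (c (a (a (a x))) (a (a (a y))))) z)

/-- The identities expressing `EquationalLaws`. -/
def equationalIdentities (τ : Sig) [Has τ Op.comp] [Has τ Op.anti] [Has τ Op.ran] :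
    List (Identity (lang τ)) :=
  let c := termBin τ Op.comp
  let a := termUn τ Op.anti
  let r := termUn τ Op.ran
  let x := .var 0
  let y := .var 1
  let z := .var 2
  [⟨c (c x y) z, c x (c y z)⟩,
   ⟨c (a x) x, c (a y) y⟩,
   ⟨c (c (a x) x) y, c (a x) x⟩,
   ⟨c (a (c (a x) x)) y, y⟩,
   ⟨c (a x) (a y), c (a y) (a x)⟩,
   ⟨c x (a y), c (a (c x y)) x⟩,
   ⟨c x (r x), x⟩,
   ⟨c (r x) (r y), c (r y) (r x)⟩,
   ⟨r (r x), r x⟩,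
   ⟨c (r (c x y)) (r y), r (c x y)⟩,
   ⟨r (c (r x) y), r (c x y)⟩,
   ⟨a (a (r x)), r x⟩,
   ⟨r (a (a x)), a (a x)⟩,
   ⟨a (c (a (r (c (a (a x)) z))) (a (r (c (a (a y)) z)))),
    r (c (a (c (a (a (a x))) (a (a (a y))))) z)⟩]

theorem forall_equationalIdentities_iff {τ : Sig} [Has τ Op.comp] [Has τ Op.anti] [Has τ Op.ran]
    {S : Type u} [(lang τ).Structure S] :
    (∀ e ∈ equationalIdentities τ, e.Holds S) ↔
      EquationalLaws (bin τ Op.comp (S := S)) (un τ Op.anti) (un τ Op.ran) := by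
  simp only [equationalIdentities, List.forall_mem_cons, Identity.Holds, Identity.At,
    realize_termBin, realize_termUn, FirstOrder.Language.Term.realize_var]
  constructor
  · rintro ⟨h₁, h₂, h₃, h₄, h₅, h₆, h₇, h₈, h₉, h₁₀, h₁₁, h₁₂, h₁₃, h₁₄, -⟩
    exact ⟨fun x y z => h₁ (assignment x y z), fun x y => h₂ (assignment x y y),
      fun x y => h₃ (assignment x y y), fun x y => h₄ (assignment x y y),
      fun x y => h₅ (assignment x y y), fun x y => h₆ (assignment x y y),
      fun x => h₇ (assignment x x x), fun x y => h₈ (assignment x y y),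
      fun x => h₉ (assignment x x x), fun x y => h₁₀ (assignment x y y),
      fun x y => h₁₁ (assignment x y y), fun x => h₁₂ (assignment x x x),
      fun x => h₁₃ (assignment x x x), fun x y z => h₁₄ (assignment x y z)⟩
  · intro h
    exact ⟨fun w => h.assoc _ _ _, fun w => h.zero _ _, fun w => h.zero_comp _ _,
      fun w => h.one_comp _ _, fun w => h.anti_comm _ _, fun w => h.anti_twisted _ _,
      fun w => h.right_id _, fun w => h.ran_comm _ _, fun w => h.ran_ran _,
      fun w => h.ran_order _ _, fun w => h.right_cong _ _, fun w => h.dom_ran _,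
      fun w => h.ran_dom _, fun w => h.antirange _ _ _, by simp⟩

section EquationalLaws

variable {S : Type u} {c m : S → S → S} {a r : S → S}

theorem AxiomsAR.anti_anti_anti (h : AxiomsAR c a r) (x : S) : a (a (a x)) = a x :=
  (h.toAntidomainRangeMonoid x).ant_ant_ant x

theorem AxiomsAR.toEquationalLaws (h : AxiomsAR c a r) : EquationalLaws c a r where
  assoc := h.modal.assoc
  zero := h.modal.antidomain.zero
  zero_comp := h.modal.antidomain.zero_comp
  one_comp := h.modal.antidomain.one_comp
  anti_comm := h.modal.antidomain.comm
  anti_twisted := h.modal.antidomain.twisted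
  right_id := h.range.right_id
  ran_comm := h.range.comm
  ran_ran := h.range.ran_ran
  ran_order := h.range.order
  right_cong := h.range.right_cong
  dom_ran := h.domainRange.dom_ran
  ran_dom := h.domainRange.ran_dom
  antirange x y z := h.antirange (a (a x)) (a (a y)) z (h.anti_anti_anti _) (h.anti_anti_anti _)

theorem EquationalLaws.axiomsAR (h : EquationalLaws c a r)
    (hu : ∀ α x y, IsDomElt a α → c α x = c α y → c (a α) x = c (a α) y → x = y)
    (hc : ∀ x y z, c x y = c x z → c (r x) y = c (r x) z) : AxiomsAR c a r where
  modal := ⟨h.assoc, h.zero, h.zero_comp, h.one_comp, h.anti_comm, h.anti_twisted, hu⟩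
  range := ⟨h.right_id, h.ran_comm, h.ran_ran, h.ran_order, h.right_cong, hc⟩
  domainRange := ⟨h.dom_ran, h.ran_dom⟩
  antirange α β x hα hβ := by
    have := h.antirange α β x
    rw [IsDomElt, derivedDom] at hα hβ
    rwa [hα, hβ] at this

theorem AxiomsMAR.join_restrict (h : AxiomsMAR c m a r) (x y : S) :
    join c a (c (a (a x)) (derivedDom a y)) (c (a x) (derivedDom a y)) = derivedDom a y := by
  obtain ⟨X, φ, hφ⟩ := h.toAxiomsAR.exists_isLocallyFreeRep
  apply hφ.injective
  rw [hφ.dom, join, hφ.anti, hφ.comp, hφ.anti, hφ.anti, hφ.comp, hφ.comp, hφ.dom]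
  refine pfun_ext fun p q => mem_join.trans ?_
  simp only [mem_pcomp, hφ.anti, mem_pdom, mem_panti]
  grind

theorem AxiomsMAR.ran_comp_dom (h : AxiomsMAR c m a r) (x y : S) :
    r (c x (derivedDom a y)) = c (r x) (derivedDom a y) := by
  obtain ⟨X, φ, hφ⟩ := h.toAxiomsAR.exists_isLocallyFreeRep
  apply hφ.injective
  rw [hφ.ran, hφ.comp, hφ.comp, hφ.ran, hφ.dom]
  refine pfun_ext fun p q => ?_
  simp only [mem_pcomp, mem_pdom, mem_pran]
  grind

/-- With intersection, two elements agree on a domain element as soon as their intersection has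
the right domain. This turns both proper quasi-identities into identities about domains. -/
theorem EquationalLaws.axiomsMAR (h : EquationalLaws c a r) (hd : DomainLaws c (derivedDom a))
    (hs : SemilatticeLaws m) (hm : MeetLaws c m (derivedDom a))
    (hj : ∀ x y, join c a (c (a (a x)) (derivedDom a y)) (c (a x) (derivedDom a y)) =
      derivedDom a y)
    (hr : ∀ x y, r (c x (derivedDom a y)) = c (r x) (derivedDom a y)) : AxiomsMAR c m a r := by
  have dom_comp : ∀ α x, IsDomElt a α →
      derivedDom a (c α x) = c α (derivedDom a x) := fun α x hα => by
    have e₁ := hd.order α x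
    have e₂ := hd.comm (c α x) α
    rw [hα] at e₁ e₂
    rw [hd.twisted, e₂, e₁]
  have union : ∀ α x y, IsDomElt a α → c α x = c α y → c (a α) x = c (a α) y →
      m x y = x := fun α x y hα h₁ h₂ => by
    have hα' : IsDomElt a (a α) := congrArg a hα
    have e₁ : c α (m x y) = c α x := by rw [hm.twisted, ← h₁, hs.idem]
    have e₂ : c (a α) (m x y) = c (a α) x := by rw [hm.twisted, ← h₂, hs.idem]
    have e : derivedDom a (m x y) = derivedDom a x := by
      have k : a (a α) = α := hα
      rw [← hj α (m x y), ← hj α x, k, ← dom_comp α _ hα, ← dom_comp α _ hα, e₁,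
        ← dom_comp _ _ hα', ← dom_comp _ _ hα', e₂]
    rw [hm.order, e, hd.left_id]
  have cancel : ∀ x y z, c x y = c x z → c (r x) y = c (r x) (m y z) := fun x y z e => by
    have e₁ : c x (m y z) = c x y := by rw [hm.twisted, ← e, hs.idem]
    have e₂ : c x (derivedDom a (m y z)) = c x (derivedDom a y) := by
      rw [hd.twisted, e₁, ← hd.twisted]
    have e₃ : c (r x) (derivedDom a (m y z)) = c (r x) (derivedDom a y) := by
      rw [← hr, e₂, hr]
    rw [hm.order, ← h.assoc, e₃, h.assoc, hd.left_id]
  have hAR := h.axiomsAR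
    (fun α x y hα h₁ h₂ => by
      rw [← union α x y hα h₁ h₂, hs.comm, union α y x hα h₁.symm h₂.symm])
    (fun x y z e => by rw [cancel x y z e, hs.comm, ← cancel x z y e.symm])
  exact ⟨hAR.modal.assoc, hd, hs, hm, hAR.modal.antidomain, hAR.range, hAR.domainRange,
    hAR.antirange⟩

end EquationalLaws

theorem isFinitelyBasedQuasivariety_sigAR :
    IsFinitelyBasedQuasivariety.{u} (L := lang sigAR) (fun S _ => Representable sigAR S) := by
  let c := termBin sigAR Op.comp
  let a := termUn sigAR Op.anti
  let r := termUn sigAR Op.ran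
  let x : (lang sigAR).Term ℕ := .var 0
  let y : (lang sigAR).Term ℕ := .var 1
  let z : (lang sigAR).Term ℕ := .var 2
  -- `x` is the domain element in the first of the two proper quasi-identities.
  let Q : List (QuasiIdentity (lang sigAR)) :=
    ⟨[⟨a (a x), x⟩, ⟨c x y, c x z⟩, ⟨c (a x) y, c (a x) z⟩], ⟨y, z⟩⟩ ::
    ⟨[⟨c x y, c x z⟩], ⟨c (r x) y, c (r x) z⟩⟩ ::
    (equationalIdentities sigAR).map fun e => ⟨[], e⟩
  refine ⟨{q | q ∈ Q}, Q.finite_toSet, fun S _ => ?_⟩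
  have hQ : (∀ q ∈ {q | q ∈ Q}, q.Holds S) ↔
      (∀ w : ℕ → S, un sigAR Op.anti (un sigAR Op.anti (w 0)) = w 0 →
        bin sigAR Op.comp (w 0) (w 1) = bin sigAR Op.comp (w 0) (w 2) →
        bin sigAR Op.comp (un sigAR Op.anti (w 0)) (w 1) =
          bin sigAR Op.comp (un sigAR Op.anti (w 0)) (w 2) → w 1 = w 2) ∧
      (∀ w : ℕ → S, bin sigAR Op.comp (w 0) (w 1) = bin sigAR Op.comp (w 0) (w 2) →
        bin sigAR Op.comp (un sigAR Op.ran (w 0)) (w 1) =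
          bin sigAR Op.comp (un sigAR Op.ran (w 0)) (w 2)) ∧
      EquationalLaws (bin sigAR Op.comp (S := S)) (un sigAR Op.anti) (un sigAR Op.ran) := by
    rw [← forall_equationalIdentities_iff]
    simp [Q, QuasiIdentity.Holds, Identity.Holds, Identity.At, realize_termBin, realize_termUn,
      c, a, r, x, y, z]
  refine representable_sigAR_iff.trans (Iff.trans ?_ hQ.symm)
  constructor
  · exact fun h => ⟨fun w => h.modal.antidomain.left_union _ _ _, fun w => h.range.cancel _ _ _,
      h.toEquationalLaws⟩
  · rintro ⟨h₁, h₂, h₃⟩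
    exact h₃.axiomsAR (fun x y z => h₁ (assignment x y z)) (fun x y z => h₂ (assignment x y z))

theorem isFinitelyBasedVariety_sigMAR :
    IsFinitelyBasedVariety.{u} (L := lang sigMAR) (fun S _ => Representable sigMAR S) := by
  let c := termBin sigMAR Op.comp
  let m := termBin sigMAR Op.meet
  let a := termUn sigMAR Op.anti
  let r := termUn sigMAR Op.ran
  let d := fun t => a (a t)
  let x : (lang sigMAR).Term ℕ := .var 0
  let y : (lang sigMAR).Term ℕ := .var 1
  let z : (lang sigMAR).Term ℕ := .var 2
  let E : List (Identity (lang sigMAR)) :=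
    [⟨c (d x) x, x⟩,
     ⟨c (d x) (d y), c (d y) (d x)⟩,
     ⟨d (d x), d x⟩,
     ⟨c (d x) (d (c x y)), d (c x y)⟩,
     ⟨c x (d y), c (d (c x y)) x⟩,
     ⟨m (m x y) z, m x (m y z)⟩,
     ⟨m x y, m y x⟩,
     ⟨m x x, x⟩,
     ⟨c x (m y z), m (c x y) (c x z)⟩,
     ⟨m x y, c (d (m x y)) x⟩,
     ⟨a (c (a (c (d x) (d y))) (a (c (a x) (d y)))), d y⟩,
     ⟨r (c x (d y)), c (r x) (d y)⟩] ++ equationalIdentities sigMAR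
  refine ⟨{e | e ∈ E}, E.finite_toSet, fun S _ => ?_⟩
  refine representable_sigMAR_iff.trans ?_
  simp only [Set.mem_ofPred_eq, E, List.forall_mem_append, List.forall_mem_cons,
    forall_equationalIdentities_iff]
  simp only [Identity.Holds, Identity.At, realize_termBin, realize_termUn,
    FirstOrder.Language.Term.realize_var, c, m, a, r, d, x, y, z]
  constructor
  · intro h
    exact ⟨⟨fun w => h.domain.left_id _, fun w => h.domain.comm _ _, fun w => h.domain.dom_dom _,
      fun w => h.domain.order _ _, fun w => h.domain.twisted _ _,
      fun w => h.semilattice.assoc _ _ _, fun w => h.semilattice.comm _ _,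
      fun w => h.semilattice.idem _, fun w => h.meet.twisted _ _ _, fun w => h.meet.order _ _,
      fun w => h.join_restrict _ _, fun w => h.ran_comp_dom _ _, by simp⟩,
      h.toAxiomsAR.toEquationalLaws⟩
  · rintro ⟨⟨h₁, h₂, h₃, h₄, h₅, h₆, h₇, h₈, h₉, h₁₀, h₁₁, h₁₂, -⟩, h⟩
    exact h.axiomsMAR
      ⟨fun x => h₁ (assignment x x x), fun x y => h₂ (assignment x y y),
        fun x => h₃ (assignment x x x), fun x y => h₄ (assignment x y y),
        fun x y => h₅ (assignment x y y)⟩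
      ⟨fun x y z => h₆ (assignment x y z), fun x y => h₇ (assignment x y y),
        fun x => h₈ (assignment x x x)⟩
      ⟨fun x y z => h₉ (assignment x y z), fun x y => h₁₀ (assignment x y y)⟩
      (fun x y => h₁₁ (assignment x y y)) (fun x y => h₁₂ (assignment x y y))

/-! ### A representable algebra with a quotient that is not representable -/

/-- The `{;, a, r}`-algebra `(S, c, a, r)`. -/
abbrev algAR {S : Type u} (c : S → S → S) (a r : S → S) : (lang sigAR).Structure S where
  funMap {n} o xs :=
    match n, o, xs with
    | _, ⟨Op.comp, _⟩, xs => c (xs 0) (xs 1)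
    | _, ⟨Op.anti, _⟩, xs => a (xs 0)
    | _, ⟨Op.ran, _⟩, xs => r (xs 0)
    | _, ⟨Op.meet, h⟩, _ => absurd h (by simp)
    | _, ⟨Op.dom, h⟩, _ => absurd h (by simp)
    | _, ⟨Op.pref, h⟩, _ => absurd h (by simp)
    | _, ⟨Op.iter, h⟩, _ => absurd h (by simp)
  RelMap R := R.elim

theorem Identity.Holds.of_surjective {τ : Sig} {S T : Type u} [(lang τ).Structure S]
    [(lang τ).Structure T] {φ : S → T} (hφ : Function.Surjective φ)
    (h : ∀ (n : ℕ) (o : (lang τ).Functions n) (xs : Fin n → S),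
      φ (FirstOrder.Language.Structure.funMap o xs) =
        FirstOrder.Language.Structure.funMap o (φ ∘ xs))
    {e : Identity (lang τ)} (he : e.Holds S) : e.Holds T := by
  intro w
  let F : FirstOrder.Language.Hom (lang τ) S T :=
    { toFun := φ, map_fun' := fun o xs => h _ o xs, map_rel' := fun R => R.elim }
  have hw : w = F ∘ fun n => Function.surjInv hφ (w n) :=
    funext fun n => (Function.surjInv_eq hφ (w n)).symm
  rw [Identity.At, hw, FirstOrder.Language.HomClass.realize_term,
    FirstOrder.Language.HomClass.realize_term, he _]

namespace Counterexample

/-- The group of order two with a zero adjoined: `none` is the zero and `some false` the unit. -/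
abbrev Z : Type := Option Bool

/-- Composition in the square of `Z`. -/
def compA (x y : Z × Z) : Z × Z := (Option.map₂ xor x.1 y.1, Option.map₂ xor x.2 y.2)

/-- Antidomain in the square of `Z`. -/
def antiA (x : Z × Z) : Z × Z :=
  (if x.1 = none then some false else none, if x.2 = none then some false else none)

/-- Range in the square of `Z`. -/
def ranA (x : Z × Z) : Z × Z := (x.1.map fun _ => false, x.2.map fun _ => false)

/-- The quotient of `Z × Z` in which a pair of group elements is identified with any other pair
with the same product, and elements with a single nonzero entry are identified when the entry is
at the same place: `inl none` is `0`, `inl (some i)` are the two domain elements strictly between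
`0` and `1'`, and `inr g` are the classes of pairs with product `g`. -/
abbrev B : Type := Option Bool ⊕ Bool

/-- Composition in the quotient. -/
def compB : B → B → B
  | .inl none, _ => .inl none
  | _, .inl none => .inl none
  | .inl (some i), .inl (some j) => if i = j then .inl (some i) else .inl none
  | .inl (some i), .inr _ => .inl (some i)
  | .inr _, .inl (some j) => .inl (some j)
  | .inr g, .inr h => .inr (xor g h)

/-- Antidomain in the quotient. -/
def antiB : B → B
  | .inl none => .inr false
  | .inl (some i) => .inl (some !i)
  | .inr _ => .inl none

/-- Range in the quotient. -/
def ranB : B → B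
  | .inl x => .inl x
  | .inr _ => .inr false

/-- The quotient map. -/
def quot : Z × Z → B
  | (none, none) => .inl none
  | (some _, none) => .inl (some false)
  | (none, some _) => .inl (some true)
  | (some g, some h) => .inr (xor g h)

theorem axiomsAR_compA : AxiomsAR compA antiA ranA where
  modal :=
    { assoc := by decide
      antidomain :=
        { zero := by decide
          zero_comp := by decide
          one_comp := by decide
          comm := by decide
          twisted := by decide
          left_union := fun α x y hα h₁ h₂ =>
            (by decide : ∀ α, antiA (antiA α) = α → ∀ x y, compA α x = compA α y ∧
              compA (antiA α) x = compA (antiA α) y → x = y) α hα x y ⟨h₁, h₂⟩ } }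
  range :=
    { right_id := by decide
      comm := by decide
      ran_ran := by decide
      order := by decide
      right_cong := by decide
      cancel := by decide }
  domainRange :=
    { dom_ran := by unfold derivedDom; decide
      ran_dom := by unfold derivedDom; decide }
  antirange := by unfold AntirangeLaw IsDomElt derivedDom join; decide

theorem quot_surjective : Function.Surjective quot := by decide

theorem quot_compA : ∀ x y, quot (compA x y) = compB (quot x) (quot y) := by decide

theorem quot_antiA : ∀ x, quot (antiA x) = antiB (quot x) := by decide

theorem quot_ranA : ∀ x, quot (ranA x) = ranB (quot x) := by decide

end Counterexample

open Counterexample in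
/-- The square of `Z` is representable, but in its quotient the distinct elements `inr false` and
`inr true` agree on a domain element and on its complement. -/
theorem not_isVariety_sigAR :
    ¬ IsVariety.{u} (L := lang sigAR) (fun S _ => Representable sigAR S) := by
  rintro ⟨E, hE⟩
  let _ : (lang sigAR).Structure (ULift.{u} (Z × Z)) :=
    algAR (fun x y => ⟨compA x.down y.down⟩) (fun x => ⟨antiA x.down⟩) (fun x => ⟨ranA x.down⟩)
  let _ : (lang sigAR).Structure (ULift.{u} B) :=
    algAR (fun x y => ⟨compB x.down y.down⟩) (fun x => ⟨antiB x.down⟩) (fun x => ⟨ranB x.down⟩)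
  have hA : Representable sigAR (ULift.{u} (Z × Z)) :=
    representable_sigAR_iff.2 <| axiomsAR_compA.pullback ULift.down_injective
      (fun _ _ => rfl) (fun _ => rfl) (fun _ => rfl)
  have hB : Representable sigAR (ULift.{u} B) := by
    refine (hE _).2 fun e he => ((hE _).1 hA e he).of_surjective
      (φ := fun x => ⟨quot x.down⟩) ?_ ?_
    · rintro ⟨y⟩
      obtain ⟨x, rfl⟩ := quot_surjective y
      exact ⟨⟨x⟩, rfl⟩
    · rintro n ⟨o, ho⟩ xs
      cases o with
      | comp => exact congrArg ULift.up (quot_compA _ _)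
      | anti => exact congrArg ULift.up (quot_antiA _)
      | ran => exact congrArg ULift.up (quot_ranA _)
      | _ => simp at ho
  have := (representable_sigAR_iff.1 hB).modal.antidomain.left_union
    ⟨.inl (some false)⟩ ⟨.inr false⟩ ⟨.inr true⟩ rfl rfl rfl
  simp at this

end FunAlg

theorem mainTheorem1 :
    -- the signature `{;, a, r}`
    (∀ (S : Type u) [(lang sigAR).Structure S],
      Representable sigAR S ↔
        AxiomsAR (bin sigAR Op.comp (S := S)) (un sigAR Op.anti) (un sigAR Op.ran)) ∧
    (IsFinitelyBasedQuasivariety.{u} (L := lang sigAR) (fun S _ => Representable sigAR S) ∧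
      ¬ IsVariety.{u} (L := lang sigAR) (fun S _ => Representable sigAR S)) ∧
    -- the signature `{;, ·, a, r}`
    (∀ (S : Type u) [(lang sigMAR).Structure S],
      Representable sigMAR S ↔
        @Representable sigMA S
            (algMA (bin sigMAR Op.comp) (bin sigMAR Op.meet) (un sigMAR Op.anti)) ∧
          @Representable sigMDR S
            (algMDR (bin sigMAR Op.comp) (bin sigMAR Op.meet)
              (derivedDom (un sigMAR Op.anti)) (un sigMAR Op.ran)) ∧
          AntirangeLaw (bin sigMAR Op.comp (S := S)) (un sigMAR Op.anti) (un sigMAR Op.ran)) ∧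
    (∀ (S : Type u) [(lang sigMAR).Structure S],
      Representable sigMAR S ↔
        AxiomsMAR (bin sigMAR Op.comp (S := S)) (bin sigMAR Op.meet)
          (un sigMAR Op.anti) (un sigMAR Op.ran)) ∧
    IsFinitelyBasedVariety.{u} (L := lang sigMAR) (fun S _ => Representable sigMAR S) ∧
    -- preferential union
    (∀ (S : Type u) [(lang (withPref sigAR)).Structure S],
      Representable (withPref sigAR) S ↔
        AxiomsAR (bin (withPref sigAR) Op.comp (S := S))
          (un (withPref sigAR) Op.anti) (un (withPref sigAR) Op.ran) ∧
        PrefLaws (bin (withPref sigAR) Op.comp (S := S))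
          (un (withPref sigAR) Op.anti) (bin (withPref sigAR) Op.pref)) ∧
    (∀ (S : Type u) [(lang (withPref sigMAR)).Structure S],
      Representable (withPref sigMAR) S ↔
        AxiomsMAR (bin (withPref sigMAR) Op.comp (S := S)) (bin (withPref sigMAR) Op.meet)
          (un (withPref sigMAR) Op.anti) (un (withPref sigMAR) Op.ran) ∧
        PrefLaws (bin (withPref sigMAR) Op.comp (S := S))
          (un (withPref sigMAR) Op.anti) (bin (withPref sigMAR) Op.pref)) ∧
    -- maximum iterate on finite algebras, without and with preferential union
    (∀ (S : Type u) [(lang (withIter sigAR)).Structure S] [Finite S],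
      Representable (withIter sigAR) S ↔
        AxiomsAR (bin (withIter sigAR) Op.comp (S := S))
          (un (withIter sigAR) Op.anti) (un (withIter sigAR) Op.ran) ∧
        IterLaws (bin (withIter sigAR) Op.comp (S := S))
          (un (withIter sigAR) Op.anti) (un (withIter sigAR) Op.iter)) ∧
    (∀ (S : Type u) [(lang (withIter sigMAR)).Structure S] [Finite S],
      Representable (withIter sigMAR) S ↔
        AxiomsMAR (bin (withIter sigMAR) Op.comp (S := S)) (bin (withIter sigMAR) Op.meet)
          (un (withIter sigMAR) Op.anti) (un (withIter sigMAR) Op.ran) ∧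
        IterLaws (bin (withIter sigMAR) Op.comp (S := S))
          (un (withIter sigMAR) Op.anti) (un (withIter sigMAR) Op.iter)) ∧
    (∀ (S : Type u) [(lang (withIter (withPref sigAR))).Structure S] [Finite S],
      Representable (withIter (withPref sigAR)) S ↔
        AxiomsAR (bin (withIter (withPref sigAR)) Op.comp (S := S))
          (un (withIter (withPref sigAR)) Op.anti) (un (withIter (withPref sigAR)) Op.ran) ∧
        PrefLaws (bin (withIter (withPref sigAR)) Op.comp (S := S))
          (un (withIter (withPref sigAR)) Op.anti) (bin (withIter (withPref sigAR)) Op.pref) ∧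
        IterLaws (bin (withIter (withPref sigAR)) Op.comp (S := S))
          (un (withIter (withPref sigAR)) Op.anti) (un (withIter (withPref sigAR)) Op.iter)) ∧
    (∀ (S : Type u) [(lang (withIter (withPref sigMAR))).Structure S] [Finite S],
      Representable (withIter (withPref sigMAR)) S ↔
        AxiomsMAR (bin (withIter (withPref sigMAR)) Op.comp (S := S))
          (bin (withIter (withPref sigMAR)) Op.meet)
          (un (withIter (withPref sigMAR)) Op.anti) (un (withIter (withPref sigMAR)) Op.ran) ∧
        PrefLaws (bin (withIter (withPref sigMAR)) Op.comp (S := S))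
          (un (withIter (withPref sigMAR)) Op.anti) (bin (withIter (withPref sigMAR)) Op.pref) ∧
        IterLaws (bin (withIter (withPref sigMAR)) Op.comp (S := S))
          (un (withIter (withPref sigMAR)) Op.anti)
          (un (withIter (withPref sigMAR)) Op.iter)) := by
  exact ⟨fun S _ => representable_sigAR_iff,
    ⟨isFinitelyBasedQuasivariety_sigAR, not_isVariety_sigAR⟩,
    fun S _ => representable_sigMAR_iff_reducts, fun S _ => representable_sigMAR_iff,
    isFinitelyBasedVariety_sigMAR,
    fun S _ => representable_withPref_sigAR_iff, fun S _ => representable_withPref_sigMAR_iff,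
    fun S _ _ => representable_withIter_sigAR_iff, fun S _ _ => representable_withIter_sigMAR_iff,
    fun S _ _ => representable_withIter_withPref_sigAR_iff,
    fun S _ _ => representable_withIter_withPref_sigMAR_iff⟩
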